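/- **The λΠ-calculus modulo theory.** Terms (up to renaming of bound variables) are $t,u ::= c \mid x \mid \mathtt{TYPE} \mid \mathtt{KIND} \mid \Pi x:t,\,u \mid \lambda x:t,\,u \mid t\,u$, where $c$ is a constant and $x$ a variable; $\mathtt{TYPE}$ and $\mathtt{KIND}$ are the sorts, denoted by $s$, and $A\to B$ is $\Pi x:A,\,B$ with $x$ not free in $B$. A rewriting rule is a pair $\ell\hookrightarrow r$ of terms with $\ell=c\,\ell_1\cdots\ell_n$, $c$ a constant. For a set $\mathcal R$ of rules, $\hookrightarrow_{\mathcal R}$ is the smallest relation containing $\mathcal R$ and closed under substitution and term constructors, $\hookrightarrow_{\beta\mathcal R}$ is its union with $\beta$-reduction, and $\equiv_{\beta\mathcal R}$ is the equivalence generated by $\hookrightarrow_{\beta\mathcal R}$. A signature $\Sigma$ is a list of declarations $c:A$ with $A$ closed; $|\Sigma|$ is the set of its constants and $\Lambda(\Sigma)$ the set of terms $t$ with $\mathrm{const}(t)\subseteq|\Sigma|$, where $\mathrm{const}(t)$ is the set of constants of $t$. Contexts are lists of declarations $x:A$. Typing $\Gamma\vdash_{\Sigma,\mathcal R}t:A$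 is defined by the following rules, simultaneously with well-formedness of contexts. - The empty context is well-formed; if $\Gamma\vdash A:s$ then $\Gamma,x:A$ is well-formed. - If $\Gamma$ is well-formed, then $\Gamma\vdash\mathtt{TYPE}:\mathtt{KIND}$; $\Gamma\vdash x:A$ for $(x:A)\in\Gamma$; and $\Gamma\vdash c:A$ for $(c:A)\in\Sigma$ with $\vdash A:s$ in the empty context. - If $\Gamma\vdash A:\mathtt{TYPE}$ and $\Gamma,x:A\vdash B:s$, then $\Gamma\vdash\Pi x:A,\,B:s$; if moreover $\Gamma,x:A\vdash t:B$, then $\Gamma\vdash\lambda x:A,\,t:\Pi x:A,\,B$. - If $\Gamma\vdash t:\Pi x:A,\,B$ and $\Gamma\vdash u:A$, then $\Gamma\vdash t\,u:(u/x)B$. - If $\Gamma\vdash t:A$, $\Gamma\vdash B:s$ and $A\equiv_{\beta\mathcal R}B$, then $\Gamma\vdash t:B$. A *system* is a pair $\Sigma,\mathcal R$ such that both sides of every rule of $\mathcal R$ are in $\Lambda(\Sigma)$. It is a *theory* if 1. $\hookrightarrow_{\beta\mathcal R}$ is confluent on $\Lambda(\Sigma)$: for all $t,u,v\in\Lambda(\Sigma)$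 with $t\hookrightarrow^*_{\beta\mathcal R}u$ and $t\hookrightarrow^*_{\beta\mathcal R}v$ there is $w\in\Lambda(\Sigma)$ with $u\hookrightarrow^*_{\beta\mathcal R}w$ and $v\hookrightarrow^*_{\beta\mathcal R}w$; and 2. every rule $\ell\hookrightarrow r$ of $\mathcal R$ preserves typing: for all contexts $\Gamma$, substitutions $\theta$ and terms $A$ of $\Lambda(\Sigma)$, if $\Gamma\vdash_{\Sigma,\mathcal R}\theta\ell:A$ then $\Gamma\vdash_{\Sigma,\mathcal R}\theta r:A$. A system $\Sigma_1,\mathcal R_1$ is a *fragment* of a system $\Sigma_0,\mathcal R_0$ if every declaration of $\Sigma_1$ is one of $\Sigma_0$ and $\mathcal R_1\subseteq\mathcal R_0$; $\mathrm{const}(A)\subseteq|\Sigma_1|$ for every $(c:A)\in\Sigma_1$; and for every $\ell\hookrightarrow r\in\mathcal R_0$ with $\mathrm{const}(\ell)\subseteq|\Sigma_1|$, one has $\mathrm{const}(r)\subseteq|\Sigma_1|$ and $\ell\hookrightarrow r\in\mathcal R_1$. **The system $\mathcal U$** has the following 43 declarations: - of type $\mathtt{TYPE}$: $I,\ \mathit{Set},\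 \mathit{Prop},\ \mathit{Set1},\ \mathit{Scheme}$; - $\mathit{El}:\mathit{Set}\to\mathtt{TYPE}$; $\ \mathit{Prf},\mathit{Prf}_c:\mathit{Prop}\to\mathtt{TYPE}$; $\ \mathit{Ty}:\mathit{Set1}\to\mathtt{TYPE}$; $\ \mathit{Els}:\mathit{Scheme}\to\mathtt{TYPE}$; - $\iota,o:\mathit{Set}$; $\ \top,\bot:\mathit{Prop}$; $\ \mathit{set}:\mathit{Set1}$; $\ 0:I$; $\ \mathit{succ},\mathit{pred}:I\to I$; $\ \mathit{positive}:I\to\mathit{Prop}$; - $\neg:\mathit{Prop}\to\mathit{Prop}$; $\ \Rightarrow,\wedge,\vee,\Rightarrow_c,\wedge_c,\vee_c:\mathit{Prop}\to\mathit{Prop}\to\mathit{Prop}$; $\ \leadsto:\mathit{Set}\to\mathit{Set}\to\mathit{Set}$ (all written infix but $\neg$); - $\forall,\exists,\forall_c,\exists_c:\Pi x:\mathit{Set},\,(\mathit{El}\,x\to\mathit{Prop})\to\mathit{Prop}$; - $\leadsto_d:\Pi x:\mathit{Set},\,(\mathit{El}\,x\to\mathit{Set})\to\mathit{Set}$; $\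 \rightsquigarrow_1:\Pi x:\mathit{Set},\,(\mathit{El}\,x\to\mathit{Set1})\to\mathit{Set1}$; $\ \Rightarrow_d:\Pi x:\mathit{Prop},\,(\mathit{Prf}\,x\to\mathit{Prop})\to\mathit{Prop}$; $\ \pi:\Pi x:\mathit{Prop},\,(\mathit{Prf}\,x\to\mathit{Set})\to\mathit{Set}$ (the first three written infix); - $\mathit{psub}:\Pi t:\mathit{Set},\,(\mathit{El}\,t\to\mathit{Prop})\to\mathit{Set}$; - $\mathit{pair}:\Pi t:\mathit{Set},\,\Pi p:\mathit{El}\,t\to\mathit{Prop},\,\Pi m:\mathit{El}\,t,\,\mathit{Prf}\,(p\,m)\to\mathit{El}\,(\mathit{psub}\,t\,p)$; - $\mathit{pair}^\dagger:\Pi t:\mathit{Set},\,\Pi p:\mathit{El}\,t\to\mathit{Prop},\,\mathit{El}\,t\to\mathit{El}\,(\mathit{psub}\,t\,p)$; - $\mathit{fst}:\Pi t:\mathit{Set},\,\Pi p:\mathit{El}\,t\to\mathit{Prop},\,\mathit{El}\,(\mathit{psub}\,t\,p)\to\mathit{El}\,t$; - $\mathit{snd}:\Pi t:\mathit{Set},\,\Pi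 p:\mathit{El}\,t\to\mathit{Prop},\,\Pi m:\mathit{El}\,(\mathit{psub}\,t\,p),\,\mathit{Prf}\,(p\,(\mathit{fst}\,t\,p\,m))$; - $\uparrow:\mathit{Set}\to\mathit{Scheme}$; $\ \mathsf A:(\mathit{Set}\to\mathit{Scheme})\to\mathit{Scheme}$; $\ \mathcal A:(\mathit{Set}\to\mathit{Prop})\to\mathit{Prop}$; and the following 31 rules: - $\mathit{El}\,\iota\hookrightarrow I$; $\ \mathit{El}\,o\hookrightarrow\mathit{Prop}$; $\ \mathit{El}\,(x\leadsto y)\hookrightarrow\mathit{El}\,x\to\mathit{El}\,y$; $\ \mathit{El}\,(x\leadsto_d y)\hookrightarrow\Pi z:\mathit{El}\,x,\,\mathit{El}\,(y\,z)$; $\ \mathit{El}\,(\pi\,x\,y)\hookrightarrow\Pi z:\mathit{Prf}\,x,\,\mathit{El}\,(y\,z)$; - $\mathit{Prf}\,(x\Rightarrow y)\hookrightarrow\mathit{Prf}\,x\to\mathit{Prf}\,y$; $\ \mathit{Prf}\,(\forall\,x\,p)\hookrightarrow\Pi z:\mathit{El}\,x,\,\mathit{Prf}\,(p\,z)$; $\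 \mathit{Prf}\,(x\Rightarrow_d y)\hookrightarrow\Pi z:\mathit{Prf}\,x,\,\mathit{Prf}\,(y\,z)$; $\ \mathit{Prf}\,(\mathcal A\,p)\hookrightarrow\Pi x:\mathit{Set},\,\mathit{Prf}\,(p\,x)$; - $\mathit{Prf}\,\top\hookrightarrow\Pi z:\mathit{Prop},\,\mathit{Prf}\,z\to\mathit{Prf}\,z$; $\ \mathit{Prf}\,\bot\hookrightarrow\Pi z:\mathit{Prop},\,\mathit{Prf}\,z$; $\ \mathit{Prf}\,(\neg x)\hookrightarrow\mathit{Prf}\,x\to\Pi z:\mathit{Prop},\,\mathit{Prf}\,z$; - $\mathit{Prf}\,(x\wedge y)\hookrightarrow\Pi z:\mathit{Prop},\,(\mathit{Prf}\,x\to\mathit{Prf}\,y\to\mathit{Prf}\,z)\to\mathit{Prf}\,z$; - $\mathit{Prf}\,(x\vee y)\hookrightarrow\Pi z:\mathit{Prop},\,(\mathit{Prf}\,x\to\mathit{Prf}\,z)\to(\mathit{Prf}\,y\to\mathit{Prf}\,z)\to\mathit{Prf}\,z$; - $\mathit{Prf}\,(\exists\,a\,p)\hookrightarrow\Pi z:\mathit{Prop},\,(\Pi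 x:\mathit{El}\,a,\,\mathit{Prf}\,(p\,x)\to\mathit{Prf}\,z)\to\mathit{Prf}\,z$; - $\mathit{Prf}_c\hookrightarrow\lambda x:\mathit{Prop},\,\mathit{Prf}\,(\neg\neg x)$; $\ \circ_c\hookrightarrow\lambda x:\mathit{Prop},\,\lambda y:\mathit{Prop},\,(\neg\neg x)\circ(\neg\neg y)$ for $\circ\in\{\Rightarrow,\wedge,\vee\}$; $\ Q_c\hookrightarrow\lambda a:\mathit{Set},\,\lambda p:\mathit{El}\,a\to\mathit{Prop},\,Q\,a\,(\lambda x:\mathit{El}\,a,\,\neg\neg(p\,x))$ for $Q\in\{\forall,\exists\}$; - $\mathit{pred}\,0\hookrightarrow0$; $\ \mathit{pred}\,(\mathit{succ}\,x)\hookrightarrow x$; $\ \mathit{positive}\,0\hookrightarrow\bot$; $\ \mathit{positive}\,(\mathit{succ}\,x)\hookrightarrow\top$; - $\mathit{pair}\,t\,p\,m\,h\hookrightarrow\mathit{pair}^\dagger\,t\,p\,m$; $\ \mathit{fst}\,t\,p\,(\mathit{pair}^\dagger\,t'\,p'\,m)\hookrightarrow m$; - $\mathit{Ty}\,\mathit{set}\hookrightarrow\mathit{Set}$;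 $\ \mathit{Ty}\,(x\rightsquigarrow_1 y)\hookrightarrow\Pi z:\mathit{El}\,x,\,\mathit{Ty}\,(y\,z)$; $\ \mathit{Els}\,(\uparrow x)\hookrightarrow\mathit{El}\,x$; $\ \mathit{Els}\,(\mathsf A\,p)\hookrightarrow\Pi x:\mathit{Set},\,\mathit{Els}\,(p\,x)$. **Theorem.** Every fragment of $\mathcal U$ is a theory. In particular, $\mathcal U$ itself is a theory. -/

import Mathlib

/-! # The λΠ-calculus modulo theory, over an arbitrary set `C` of constants

Terms are taken up to renaming of bound variables, by means of de Bruijn indices. -/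

namespace LambdaPi

/-- The two sorts. -/
inductive Srt where
  | type
  | kind

/-- Terms: constants, variables, `TYPE`, `KIND`, products, abstractions and applications.
In `pi A B` and `lam A t` the index `0` is bound in `B`, respectively in `t`. -/
inductive Term (C : Type*) where
  | const (c : C)
  | var (i : ℕ)
  | sort (s : Srt)
  | pi (A B : Term C)
  | lam (A t : Term C)
  | app (t u : Term C)

namespace Term

variable {C : Type*}

/-- Extension of a renaming under one binder. -/
def upRen (ξ : ℕ → ℕ) : ℕ → ℕ
  | 0 => 0
  | i + 1 => ξ i + 1

/-- Renaming of the free variables. -/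
def rename : (ℕ → ℕ) → Term C → Term C
  | _, const c => const c
  | ξ, var i => var (ξ i)
  | _, sort s => sort s
  | ξ, pi A B => pi (rename ξ A) (rename (upRen ξ) B)
  | ξ, lam A t => lam (rename ξ A) (rename (upRen ξ) t)
  | ξ, app t u => app (rename ξ t) (rename ξ u)

/-- Extension of a substitution under one binder. -/
def up (θ : ℕ → Term C) : ℕ → Term C
  | 0 => var 0
  | i + 1 => rename Nat.succ (θ i)

/-- Capture-avoiding simultaneous substitution. -/
def subst : (ℕ → Term C) → Term C → Term C
  | _, const c => const c
  | θ, var i => θ i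
  | _, sort s => sort s
  | θ, pi A B => pi (subst θ A) (subst (up θ) B)
  | θ, lam A t => lam (subst θ A) (subst (up θ) t)
  | θ, app t u => app (subst θ t) (subst θ u)

/-- The substitution that replaces the index `0` by `u` and lowers the other indices. -/
def single (u : Term C) : ℕ → Term C
  | 0 => u
  | i + 1 => var i

/-- `inst u B` is the term `(u/x)B`, where `x` is the variable of index `0` in `B`. -/
def inst (u B : Term C) : Term C := subst (single u) B

/-- The non-dependent product `A → B`. -/
def arr (A B : Term C) : Term C := pi A (rename Nat.succ B)

/-- The set of constants that occur in a term. -/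
def consts : Term C → Set C
  | const c => {c}
  | var _ => ∅
  | sort _ => ∅
  | pi A B => consts A ∪ consts B
  | lam A t => consts A ∪ consts t
  | app t u => consts t ∪ consts u

/-- All the free variables have an index smaller than `k`. -/
def FreeBelow : ℕ → Term C → Prop
  | _, const _ => True
  | k, var i => i < k
  | _, sort _ => True
  | k, pi A B => FreeBelow k A ∧ FreeBelow (k + 1) B
  | k, lam A t => FreeBelow k A ∧ FreeBelow (k + 1) t
  | k, app t u => FreeBelow k t ∧ FreeBelow k u

/-- A closed term has no free variable. -/
def Closed (t : Term C) : Prop := FreeBelow 0 t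

/-- `apps t [u₁, …, uₙ]` is `t u₁ … uₙ`. -/
def apps (t : Term C) (us : List (Term C)) : Term C := us.foldl app t

end Term

open Term

/-- A rewriting rule `c ℓ₁ … ℓₙ ↪ r`. -/
structure Rule (C : Type*) where
  head : C
  args : List (Term C)
  rhs : Term C

/-- The left-hand side of a rule. -/
def Rule.lhs {C : Type*} (ρ : Rule C) : Term C := apps (const ρ.head) ρ.args

section Reduction

variable {C : Type*}

/-- The smallest relation closed by term constructors containing `r`. -/
inductive Compat (r : Term C → Term C → Prop) : Term C → Term C → Prop
  | root {t u} : r t u → Compat r t u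
  | piL {A A' B} : Compat r A A' → Compat r (pi A B) (pi A' B)
  | piR {A B B'} : Compat r B B' → Compat r (pi A B) (pi A B')
  | lamL {A A' t} : Compat r A A' → Compat r (lam A t) (lam A' t)
  | lamR {A t t'} : Compat r t t' → Compat r (lam A t) (lam A t')
  | appL {t t' u} : Compat r t t' → Compat r (app t u) (app t' u)
  | appR {t u u'} : Compat r u u' → Compat r (app t u) (app t u')

/-- Contraction of a β-redex. -/
inductive BetaRoot : Term C → Term C → Prop
  | beta (A t u : Term C) : BetaRoot (app (lam A t) u) (inst u t)

/-- Contraction of an instance of a rule of `R`. -/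
inductive RuleRoot (R : Set (Rule C)) : Term C → Term C → Prop
  | rule {ρ : Rule C} (hρ : ρ ∈ R) (θ : ℕ → Term C) :
      RuleRoot R (subst θ ρ.lhs) (subst θ ρ.rhs)

/-- The relation `↪_β`. -/
def BetaStep : Term C → Term C → Prop := Compat BetaRoot

/-- The relation `↪_R`. -/
def RuleStep (R : Set (Rule C)) : Term C → Term C → Prop := Compat (RuleRoot R)

/-- The relation `↪_βR`, that is `↪_β ∪ ↪_R`. -/
def Step (R : Set (Rule C)) (t u : Term C) : Prop := BetaStep t u ∨ RuleStep R t u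

/-- The relation `≡_βR`. -/
def Conv (R : Set (Rule C)) : Term C → Term C → Prop := Relation.EqvGen (Step R)

/-- Confluence of a relation on a set of terms. -/
def ConfluentOn (r : Term C → Term C → Prop) (L : Set (Term C)) : Prop :=
  ∀ t ∈ L, ∀ u ∈ L, ∀ v ∈ L, Relation.ReflTransGen r t u → Relation.ReflTransGen r t v →
    ∃ w ∈ L, Relation.ReflTransGen r u w ∧ Relation.ReflTransGen r v w

end Reduction

/-- A signature: a list of declarations `c : A` with `A` closed. -/
structure Signature (C : Type*) where
  decls : List (C × Term C)
  closed : ∀ d ∈ decls, d.2.Closed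

/-- The set `|Σ|` of declared constants. -/
def Signature.dom {C : Type*} (S : Signature C) : Set C := {c | ∃ A, (c, A) ∈ S.decls}

/-- The set `Λ(Σ)` of the terms all of whose constants are declared. -/
def Signature.terms {C : Type*} (S : Signature C) : Set (Term C) := {t | t.consts ⊆ S.dom}

/-- A context. The head of the list is the type of the variable of index `0`, the last variable
declared; each type lives in the context formed by the tail that follows it. -/
abbrev Ctx (C : Type*) := List (Term C)

/-- The two forms of judgement: `Γ` is well-formed, and `Γ ⊢ t : A`. -/
inductive Judgement (C : Type*) where
  | wf (Γ : Ctx C)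
  | typ (Γ : Ctx C) (t A : Term C)

open Judgement in
/-- Derivability, with signature `S` and rewriting rules `R`. -/
inductive Derivable {C : Type*} (S : Signature C) (R : Set (Rule C)) : Judgement C → Prop
  | empty : Derivable S R (wf [])
  | decl {Γ A s} : Derivable S R (typ Γ A (sort s)) → Derivable S R (wf (A :: Γ))
  | sort {Γ} : Derivable S R (wf Γ) → Derivable S R (typ Γ (sort .type) (sort .kind))
  | const {Γ c A s} : Derivable S R (wf Γ) → Derivable S R (typ [] A (sort s)) →
      (c, A) ∈ S.decls → Derivable S R (typ Γ (const c) A)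
  | var {Γ i A} : Derivable S R (wf Γ) → Γ[i]? = some A →
      Derivable S R (typ Γ (var i) (rename (fun j => j + (i + 1)) A))
  | prod {Γ A B s} : Derivable S R (typ Γ A (sort .type)) →
      Derivable S R (typ (A :: Γ) B (sort s)) → Derivable S R (typ Γ (pi A B) (sort s))
  | abs {Γ A B t s} : Derivable S R (typ Γ A (sort .type)) →
      Derivable S R (typ (A :: Γ) B (sort s)) → Derivable S R (typ (A :: Γ) t B) →
      Derivable S R (typ Γ (lam A t) (pi A B))
  | app {Γ t u A B} : Derivable S R (typ Γ t (pi A B)) → Derivable S R (typ Γ u A) →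
      Derivable S R (typ Γ (app t u) (inst u B))
  | conv {Γ t A B s} : Derivable S R (typ Γ t A) → Derivable S R (typ Γ B (sort s)) →
      Conv R A B → Derivable S R (typ Γ t B)

/-- The typing judgement `Γ ⊢ t : A`. -/
def HasType {C : Type*} (S : Signature C) (R : Set (Rule C)) (Γ : Ctx C) (t A : Term C) : Prop :=
  Derivable S R (.typ Γ t A)

/-- A rule preserves typing in `S, R`. -/
def Rule.PreservesTyping {C : Type*} (ρ : Rule C) (S : Signature C) (R : Set (Rule C)) : Prop :=
  ∀ (Γ : Ctx C) (θ : ℕ → Term C) (A : Term C),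
    (∀ B ∈ Γ, B ∈ S.terms) → (∀ i, θ i ∈ S.terms) → A ∈ S.terms →
    HasType S R Γ (subst θ ρ.lhs) A → HasType S R Γ (subst θ ρ.rhs) A

/-- A system: a signature and a set of rules between terms of that signature. -/
structure System (C : Type*) where
  sig : Signature C
  rules : Set (Rule C)
  rules_mem : ∀ ρ ∈ rules, ρ.lhs ∈ sig.terms ∧ ρ.rhs ∈ sig.terms

/-- A theory: a system that is confluent and whose rules preserve typing. -/
structure System.IsTheory {C : Type*} (T : System C) : Prop where
  confluent : ConfluentOn (Step T.rules) T.sig.terms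
  preserves : ∀ ρ ∈ T.rules, ρ.PreservesTyping T.sig T.rules

/-- `T₁` is a fragment of `T₀`. -/
structure System.IsFragment {C : Type*} (T₁ T₀ : System C) : Prop where
  sig_subset : ∀ d ∈ T₁.sig.decls, d ∈ T₀.sig.decls
  rules_subset : T₁.rules ⊆ T₀.rules
  sig_consts : ∀ d ∈ T₁.sig.decls, d.2.consts ⊆ T₁.sig.dom
  rules_closed : ∀ ρ ∈ T₀.rules, ρ.lhs.consts ⊆ T₁.sig.dom →
    ρ.rhs.consts ⊆ T₁.sig.dom ∧ ρ ∈ T₁.rules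

/-! # The theory U -/

/-- The 43 constants of the theory U. -/
inductive USym where
  /-- `I` -/
  | ind
  /-- `Set` -/
  | set
  /-- `El` -/
  | el
  /-- `ι` -/
  | iota
  /-- `Prop` -/
  | prop
  /-- `Prf` -/
  | prf
  /-- `⇒` -/
  | imp
  /-- `∀` -/
  | all
  /-- `⊤` -/
  | top
  /-- `⊥` -/
  | bot
  /-- `¬` -/
  | neg
  /-- `∧` -/
  | and
  /-- `∨` -/
  | or
  /-- `∃` -/
  | ex
  /-- `Prf_c` -/
  | prfC
  /-- `⇒_c` -/
  | impC
  /-- `∧_c` -/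
  | andC
  /-- `∨_c` -/
  | orC
  /-- `∀_c` -/
  | allC
  /-- `∃_c` -/
  | exC
  /-- `o` -/
  | o
  /-- `⇝`, the arrow of type `Set → Set → Set` -/
  | arrow
  /-- `⇝_d`, the dependent arrow with values in `Set` -/
  | arrowD
  /-- `⇒_d` -/
  | impD
  /-- `π` -/
  | pi
  /-- `0` -/
  | zero
  /-- `succ` -/
  | succ
  /-- `pred` -/
  | pred
  /-- `positive` -/
  | positive
  /-- `psub` -/
  | psub
  /-- `pair` -/
  | pair
  /-- `pair†` -/
  | pairDag
  /-- `fst` -/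
  | fst
  /-- `snd` -/
  | snd
  /-- `Set1` -/
  | set1
  /-- `set`, the constant of type `Set1` -/
  | setCode
  /-- The dependent arrow with values in `Set1` -/
  | arrowSet1
  /-- `Ty` -/
  | ty
  /-- `Scheme` -/
  | scheme
  /-- `Els` -/
  | els
  /-- `↑` -/
  | lift
  /-- The quantifier over `Set` in schemes -/
  | allScheme
  /-- The quantifier over `Set` in propositions -/
  | allProp

namespace U

/-- The term `TYPE`. -/
def tType : Term USym := sort .type
/-- The term `I`. -/
def tI : Term USym := const .ind
/-- The term `Set`. -/
def tSet : Term USym := const .set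
/-- The term `Prop`. -/
def tProp : Term USym := const .prop
/-- The term `Set1`. -/
def tSet1 : Term USym := const .set1
/-- The term `Scheme`. -/
def tScheme : Term USym := const .scheme
/-- The term `El t`. -/
def el (t : Term USym) : Term USym := app (const .el) t
/-- The term `Prf t`. -/
def prf (t : Term USym) : Term USym := app (const .prf) t
/-- The term `Ty t`. -/
def ty (t : Term USym) : Term USym := app (const .ty) t
/-- The term `Els t`. -/
def els (t : Term USym) : Term USym := app (const .els) t
/-- The term `¬ ¬ t`. -/
def negneg (t : Term USym) : Term USym := app (const .neg) (app (const .neg) t)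
/-- The term `c t u`. -/
def bin (c : USym) (t u : Term USym) : Term USym := app (app (const c) t) u

/-- The declarations of the theory U. -/
def decls : List (USym × Term USym) :=
  [ (.ind, tType),
    (.set, tType),
    (.el, arr tSet tType),
    (.iota, tSet),
    (.prop, tType),
    (.prf, arr tProp tType),
    (.imp, arr tProp (arr tProp tProp)),
    (.all, pi tSet (arr (arr (el (var 0)) tProp) tProp)),
    (.top, tProp),
    (.bot, tProp),
    (.neg, arr tProp tProp),
    (.and, arr tProp (arr tProp tProp)),
    (.or, arr tProp (arr tProp tProp)),
    (.ex, pi tSet (arr (arr (el (var 0)) tProp) tProp)),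
    (.prfC, arr tProp tType),
    (.impC, arr tProp (arr tProp tProp)),
    (.andC, arr tProp (arr tProp tProp)),
    (.orC, arr tProp (arr tProp tProp)),
    (.allC, pi tSet (arr (arr (el (var 0)) tProp) tProp)),
    (.exC, pi tSet (arr (arr (el (var 0)) tProp) tProp)),
    (.o, tSet),
    (.arrow, arr tSet (arr tSet tSet)),
    (.arrowD, pi tSet (arr (arr (el (var 0)) tSet) tSet)),
    (.impD, pi tProp (arr (arr (prf (var 0)) tProp) tProp)),
    (.pi, pi tProp (arr (arr (prf (var 0)) tSet) tSet)),
    (.zero, tI),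
    (.succ, arr tI tI),
    (.pred, arr tI tI),
    (.positive, arr tI tProp),
    (.psub, pi tSet (arr (arr (el (var 0)) tProp) tSet)),
    -- `Π t : Set, Π p : El t → Prop, Π m : El t, Prf (p m) → El (psub t p)`
    (.pair, pi tSet (pi (arr (el (var 0)) tProp) (pi (el (var 1))
      (arr (prf (app (var 1) (var 0))) (el (bin .psub (var 2) (var 1))))))),
    -- `Π t : Set, Π p : El t → Prop, El t → El (psub t p)`
    (.pairDag, pi tSet (pi (arr (el (var 0)) tProp)
      (arr (el (var 1)) (el (bin .psub (var 1) (var 0)))))),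
    -- `Π t : Set, Π p : El t → Prop, El (psub t p) → El t`
    (.fst, pi tSet (pi (arr (el (var 0)) tProp)
      (arr (el (bin .psub (var 1) (var 0))) (el (var 1))))),
    -- `Π t : Set, Π p : El t → Prop, Π m : El (psub t p), Prf (p (fst t p m))`
    (.snd, pi tSet (pi (arr (el (var 0)) tProp) (pi (el (bin .psub (var 1) (var 0)))
      (prf (app (var 1) (apps (const .fst) [var 2, var 1, var 0])))))),
    (.set1, tType),
    (.setCode, tSet1),
    (.arrowSet1, pi tSet (arr (arr (el (var 0)) tSet1) tSet1)),
    (.ty, arr tSet1 tType),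
    (.scheme, tType),
    (.els, arr tScheme tType),
    (.lift, arr tSet tScheme),
    (.allScheme, arr (arr tSet tScheme) tScheme),
    (.allProp, arr (arr tSet tProp) tProp) ]

/-- The rules of the theory U. The variables `x`, `y` of a rule in the comments are the free
indices `0`, `1` of its two sides; under a binder of a right-hand side they are shifted. -/
def rules : List (Rule USym) :=
  [ -- `El ι ↪ I`
    ⟨.el, [const .iota], tI⟩,
    -- `Prf (x ⇒ y) ↪ Prf x → Prf y`
    ⟨.prf, [bin .imp (var 0) (var 1)], arr (prf (var 0)) (prf (var 1))⟩,
    -- `Prf (∀ x y) ↪ Π z : El x, Prf (y z)`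
    ⟨.prf, [bin .all (var 0) (var 1)], pi (el (var 0)) (prf (app (var 2) (var 0)))⟩,
    -- `Prf ⊤ ↪ Π z : Prop, Prf z → Prf z`
    ⟨.prf, [const .top], pi tProp (arr (prf (var 0)) (prf (var 0)))⟩,
    -- `Prf ⊥ ↪ Π z : Prop, Prf z`
    ⟨.prf, [const .bot], pi tProp (prf (var 0))⟩,
    -- `Prf (¬ x) ↪ Prf x → Π z : Prop, Prf z`
    ⟨.prf, [app (const .neg) (var 0)], arr (prf (var 0)) (pi tProp (prf (var 0)))⟩,
    -- `Prf (x ∧ y) ↪ Π z : Prop, (Prf x → Prf y → Prf z) → Prf z`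
    ⟨.prf, [bin .and (var 0) (var 1)],
      pi tProp (arr (arr (prf (var 1)) (arr (prf (var 2)) (prf (var 0)))) (prf (var 0)))⟩,
    -- `Prf (x ∨ y) ↪ Π z : Prop, (Prf x → Prf z) → (Prf y → Prf z) → Prf z`
    ⟨.prf, [bin .or (var 0) (var 1)],
      pi tProp (arr (arr (prf (var 1)) (prf (var 0)))
        (arr (arr (prf (var 2)) (prf (var 0))) (prf (var 0))))⟩,
    -- `Prf (∃ x y) ↪ Π z : Prop, (Π a : El x, Prf (y a) → Prf z) → Prf z`
    ⟨.prf, [bin .ex (var 0) (var 1)],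
      pi tProp (arr (pi (el (var 1)) (arr (prf (app (var 3) (var 0))) (prf (var 1))))
        (prf (var 0)))⟩,
    -- `Prf_c ↪ λ x : Prop, Prf (¬ ¬ x)`
    ⟨.prfC, [], lam tProp (prf (negneg (var 0)))⟩,
    -- `⇒_c ↪ λ x : Prop, λ y : Prop, (¬ ¬ x) ⇒ (¬ ¬ y)`
    ⟨.impC, [], lam tProp (lam tProp (bin .imp (negneg (var 1)) (negneg (var 0))))⟩,
    -- `∧_c ↪ λ x : Prop, λ y : Prop, (¬ ¬ x) ∧ (¬ ¬ y)`
    ⟨.andC, [], lam tProp (lam tProp (bin .and (negneg (var 1)) (negneg (var 0))))⟩,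
    -- `∨_c ↪ λ x : Prop, λ y : Prop, (¬ ¬ x) ∨ (¬ ¬ y)`
    ⟨.orC, [], lam tProp (lam tProp (bin .or (negneg (var 1)) (negneg (var 0))))⟩,
    -- `∀_c ↪ λ a : Set, λ p : El a → Prop, ∀ a (λ x : El a, ¬ ¬ (p x))`
    ⟨.allC, [], lam tSet (lam (arr (el (var 0)) tProp)
      (bin .all (var 1) (lam (el (var 1)) (negneg (app (var 1) (var 0))))))⟩,
    -- `∃_c ↪ λ a : Set, λ p : El a → Prop, ∃ a (λ x : El a, ¬ ¬ (p x))`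
    ⟨.exC, [], lam tSet (lam (arr (el (var 0)) tProp)
      (bin .ex (var 1) (lam (el (var 1)) (negneg (app (var 1) (var 0))))))⟩,
    -- `El o ↪ Prop`
    ⟨.el, [const .o], tProp⟩,
    -- `El (x ⇝ y) ↪ El x → El y`
    ⟨.el, [bin .arrow (var 0) (var 1)], arr (el (var 0)) (el (var 1))⟩,
    -- `El (x ⇝_d y) ↪ Π z : El x, El (y z)`
    ⟨.el, [bin .arrowD (var 0) (var 1)], pi (el (var 0)) (el (app (var 2) (var 0)))⟩,
    -- `Prf (x ⇒_d y) ↪ Π z : Prf x, Prf (y z)`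
    ⟨.prf, [bin .impD (var 0) (var 1)], pi (prf (var 0)) (prf (app (var 2) (var 0)))⟩,
    -- `El (π x y) ↪ Π z : Prf x, El (y z)`
    ⟨.el, [bin .pi (var 0) (var 1)], pi (prf (var 0)) (el (app (var 2) (var 0)))⟩,
    -- `pred 0 ↪ 0`
    ⟨.pred, [const .zero], const .zero⟩,
    -- `pred (succ x) ↪ x`
    ⟨.pred, [app (const .succ) (var 0)], var 0⟩,
    -- `positive 0 ↪ ⊥`
    ⟨.positive, [const .zero], const .bot⟩,
    -- `positive (succ x) ↪ ⊤`
    ⟨.positive, [app (const .succ) (var 0)], const .top⟩,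
    -- `pair t p m h ↪ pair† t p m`, with `t`, `p`, `m`, `h` the indices `0`, `1`, `2`, `3`
    ⟨.pair, [var 0, var 1, var 2, var 3], apps (const .pairDag) [var 0, var 1, var 2]⟩,
    -- `fst t p (pair† t₁ p₁ m) ↪ m`, with `t`, `p`, `t₁`, `p₁`, `m` the indices `0`, …, `4`
    ⟨.fst, [var 0, var 1, apps (const .pairDag) [var 2, var 3, var 4]], var 4⟩,
    -- `Ty set ↪ Set`
    ⟨.ty, [const .setCode], tSet⟩,
    -- `Ty (x ⇝_d y) ↪ Π z : El x, Ty (y z)`, for the dependent arrow with values in `Set1`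
    ⟨.ty, [bin .arrowSet1 (var 0) (var 1)], pi (el (var 0)) (ty (app (var 2) (var 0)))⟩,
    -- `Els (↑ x) ↪ El x`
    ⟨.els, [app (const .lift) (var 0)], el (var 0)⟩,
    -- `Els (allScheme x) ↪ Π z : Set, Els (x z)`
    ⟨.els, [app (const .allScheme) (var 0)], pi tSet (els (app (var 1) (var 0)))⟩,
    -- `Prf (allProp x) ↪ Π z : Set, Prf (x z)`
    ⟨.prf, [app (const .allProp) (var 0)], pi tSet (prf (app (var 1) (var 0)))⟩ ]

theorem decls_closed : ∀ d ∈ decls, d.2.Closed := by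
  simp [decls, Closed, FreeBelow, arr, rename, apps, bin, el, prf, tType, tI, tSet, tProp,
    tSet1, tScheme]

/-- The signature of the theory U. -/
def sig : Signature USym := ⟨decls, decls_closed⟩

theorem mem_dom (c : USym) : c ∈ sig.dom := by
  cases c <;> simp [Signature.dom, sig, decls]

/-- The theory U: 43 declarations and 31 rules, including the declaration of `pair†` and the rule
of `pair`. -/
def system : System USym where
  sig := sig
  rules := {ρ | ρ ∈ rules}
  rules_mem := fun _ _ => ⟨fun c _ => mem_dom c, fun c _ => mem_dom c⟩

end U

end LambdaPi

namespace LambdaPi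

open Term

/-! # Substitution -/

namespace Term

variable {C : Type*}

/-! Confluence. The 31 rules are left-linear, their left-hand sides are built from constants and
variables with no variable in head position, and no left-hand side has a common instance with
another one or with a non-variable proper subterm of any left-hand side. So neither two rules nor a
rule and β overlap. For such orthogonal rules, the Tait and Martin-Löf method applies: parallel
reduction has the diamond property (`Par.diamond`) and the same reflexive-transitive closure as
`Step`. Everything is proved for an arbitrary subset `R` of an orthogonal list `L`, hence for all
fragments at once; orthogonality of the concrete list is decided by computation
(`orthogonal_rules`). Reduction creates no undeclared constant, so confluence restricts to the terms
of the fragment.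

Preservation of typing. Confluence gives injectivity of products modulo conversion. Hence the types
of a constant applied to arguments are all convertible to the instance of its declared type, and the
arguments have the types that the declaration requires (`TypesConv.app`, `TypesConv.arg`). For each
rule, this inversion types the values of the pattern variables; the right-hand side is then typed at
the declared result type of the left-hand side and moved to the given type by conversion. The
declared types are themselves typable in the fragment because it contains the constants that they
mention, and it contains those of the right-hand side as well.

The delicate rule is that of `fst`. Left-linearity forces distinct variables `t` and `t'`, so its
right-hand side has a priori type `El t'` where `El t` is wanted. Since `El (psub t p)` overlaps
with no rule, convertibility of two such types forces `t` and `t'` to be convertible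
(`el_psub_inj`). -/

theorem upRen_comp (ξ ζ : ℕ → ℕ) : upRen (fun i => ξ (ζ i)) = fun i => upRen ξ (upRen ζ i) := by
  funext i; cases i <;> rfl

theorem rename_rename (t : Term C) : ∀ ξ ζ : ℕ → ℕ,
    rename ξ (rename ζ t) = rename (fun i => ξ (ζ i)) t := by
  induction t <;> intro ξ ζ <;> simp_all [rename, upRen_comp]

theorem up_upRen (θ : ℕ → Term C) (ξ : ℕ → ℕ) :
    (fun i => up θ (upRen ξ i)) = up fun i => θ (ξ i) := by
  funext i; cases i <;> rfl

theorem subst_rename (t : Term C) : ∀ (θ : ℕ → Term C) (ξ : ℕ → ℕ),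
    subst θ (rename ξ t) = subst (fun i => θ (ξ i)) t := by
  induction t <;> intro θ ξ <;> simp_all [rename, subst, up_upRen]

theorem rename_upRen_up (ξ : ℕ → ℕ) (θ : ℕ → Term C) :
    (fun i => rename (upRen ξ) (up θ i)) = up fun i => rename ξ (θ i) := by
  funext i
  cases i with
  | zero => rfl
  | succ i => simp only [up, rename_rename]; rfl

theorem rename_subst (t : Term C) : ∀ (ξ : ℕ → ℕ) (θ : ℕ → Term C),
    rename ξ (subst θ t) = subst (fun i => rename ξ (θ i)) t := by
  induction t <;> intro ξ θ <;> simp_all [rename, subst, rename_upRen_up]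

theorem subst_up_up (σ θ : ℕ → Term C) :
    (fun i => subst (up σ) (up θ i)) = up fun i => subst σ (θ i) := by
  funext i
  cases i with
  | zero => rfl
  | succ i => simp only [up, subst_rename, rename_subst]

/-- Under a binder this needs `subst_up_up`, which rests on the laws for a renaming before and after
a substitution; hence the order of the composition lemmas. -/
theorem subst_subst (t : Term C) : ∀ σ θ : ℕ → Term C,
    subst σ (subst θ t) = subst (fun i => subst σ (θ i)) t := by
  induction t <;> intro σ θ <;> simp_all [subst, subst_up_up]

theorem up_var : up (var : ℕ → Term C) = var := by
  funext i; cases i <;> rfl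

theorem subst_var (t : Term C) : subst var t = t := by
  induction t <;> simp_all [subst, up_var]

theorem up_var_comp (ξ : ℕ → ℕ) : up (fun i => (var (ξ i) : Term C)) = fun i => var (upRen ξ i) := by
  funext i; cases i <;> rfl

theorem rename_eq_subst (t : Term C) : ∀ ξ : ℕ → ℕ,
    rename ξ t = subst (fun i => var (ξ i)) t := by
  induction t <;> intro ξ <;> simp_all [rename, subst, up_var_comp]

/-- This commutation makes β-reduction and the application rule of typing stable under substitution.
-/
theorem subst_inst (θ : ℕ → Term C) (u B : Term C) :
    subst θ (inst u B) = inst (subst θ u) (subst (up θ) B) := by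
  simp only [inst, subst_subst]
  congr 1
  funext i
  cases i with
  | zero => rfl
  | succ i =>
    simp only [single, up, subst_rename, subst]
    exact (subst_var _).symm

theorem inst_rename_succ (u B : Term C) : inst u (rename Nat.succ B) = B := by
  rw [inst, subst_rename]
  exact subst_var B

theorem rename_inst (ξ : ℕ → ℕ) (u B : Term C) :
    rename ξ (inst u B) = inst (rename ξ u) (rename (upRen ξ) B) := by
  rw [rename_eq_subst, subst_inst, up_var_comp, ← rename_eq_subst, ← rename_eq_subst]

theorem subst_arr (θ : ℕ → Term C) (A B : Term C) :
    subst θ (arr A B) = arr (subst θ A) (subst θ B) := by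
  simp only [arr, subst, subst_rename, rename_subst, up]

theorem rename_arr (ξ : ℕ → ℕ) (A B : Term C) :
    rename ξ (arr A B) = arr (rename ξ A) (rename ξ B) := by
  simp only [rename_eq_subst, subst_arr]

theorem subst_congr {t : Term C} : ∀ {k : ℕ} {θ σ : ℕ → Term C}, t.FreeBelow k →
    (∀ i < k, θ i = σ i) → subst θ t = subst σ t := by
  have hup : ∀ {k : ℕ} {θ σ : ℕ → Term C}, (∀ i < k, θ i = σ i) →
      ∀ i < k + 1, up θ i = up σ i := by
    intro k θ σ h i hi
    cases i with
    | zero => rfl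
    | succ i => simp only [up, h i (by omega)]
  induction t with
  | const c => intros; rfl
  | var i => intro k θ σ ht h; exact h i ht
  | sort s => intros; rfl
  | pi A B ihA ihB =>
    intro k θ σ ht h
    simp only [subst, ihA ht.1 h, ihB ht.2 (hup h)]
  | lam A B ihA ihB =>
    intro k θ σ ht h
    simp only [subst, ihA ht.1 h, ihB ht.2 (hup h)]
  | app A B ihA ihB =>
    intro k θ σ ht h
    simp only [subst, ihA ht.1 h, ihB ht.2 h]

theorem Closed.subst_eq {t : Term C} (ht : t.Closed) (θ : ℕ → Term C) : subst θ t = t := by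
  rw [subst_congr (σ := var) ht (fun i hi => absurd hi (Nat.not_lt_zero i)), subst_var]

theorem Closed.rename_eq {t : Term C} (ht : t.Closed) (ξ : ℕ → ℕ) : rename ξ t = t := by
  rw [rename_eq_subst, ht.subst_eq]

end Term

/-! # Reduction and conversion -/

section Reduction

variable {C : Type*} {R : Set (Rule C)}

open Relation

theorem Compat.subst {r : Term C → Term C → Prop}
    (hr : ∀ (θ : ℕ → Term C) t u, r t u → r (subst θ t) (subst θ u)) {t u : Term C}
    (h : Compat r t u) : ∀ θ : ℕ → Term C, Compat r (subst θ t) (subst θ u) := by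
  induction h with
  | root h => exact fun θ => .root (hr θ _ _ h)
  | piL _ ih => exact fun θ => .piL (ih θ)
  | piR _ ih => exact fun θ => .piR (ih _)
  | lamL _ ih => exact fun θ => .lamL (ih θ)
  | lamR _ ih => exact fun θ => .lamR (ih _)
  | appL _ ih => exact fun θ => .appL (ih θ)
  | appR _ ih => exact fun θ => .appR (ih θ)

theorem Step.subst (θ : ℕ → Term C) {t u : Term C} (h : Step R t u) :
    Step R (subst θ t) (subst θ u) := by
  rcases h with h | h
  · refine .inl (h.subst ?_ θ)
    rintro θ _ _ ⟨A, t, u⟩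
    rw [subst_inst]
    exact .beta _ _ _
  · refine .inr (h.subst ?_ θ)
    rintro θ _ _ ⟨hρ, σ⟩
    rw [subst_subst, subst_subst]
    exact .rule hρ _

theorem Step.piL {A A' : Term C} (B) (h : Step R A A') : Step R (pi A B) (pi A' B) :=
  h.imp .piL .piL
theorem Step.piR (A) {B B' : Term C} (h : Step R B B') : Step R (pi A B) (pi A B') :=
  h.imp .piR .piR
theorem Step.lamL {A A' : Term C} (t) (h : Step R A A') : Step R (lam A t) (lam A' t) :=
  h.imp .lamL .lamL
theorem Step.lamR (A) {t t' : Term C} (h : Step R t t') : Step R (lam A t) (lam A t') :=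
  h.imp .lamR .lamR
theorem Step.appL {t t' : Term C} (u) (h : Step R t t') : Step R (app t u) (app t' u) :=
  h.imp .appL .appL
theorem Step.appR (t) {u u' : Term C} (h : Step R u u') : Step R (app t u) (app t u') :=
  h.imp .appR .appR

/-- The reflexive and transitive closure of `Step`. -/
abbrev Steps (R : Set (Rule C)) : Term C → Term C → Prop := ReflTransGen (Step R)

theorem Steps.pi {A A' B B' : Term C} (hA : Steps R A A') (hB : Steps R B B') :
    Steps R (pi A B) (pi A' B') :=
  (hA.lift (Term.pi · B) fun _ _ => Step.piL B).trans (hB.lift (Term.pi A') fun _ _ => Step.piR A')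

theorem Steps.lam {A A' t t' : Term C} (hA : Steps R A A') (ht : Steps R t t') :
    Steps R (lam A t) (lam A' t') :=
  (hA.lift (Term.lam · t) fun _ _ => Step.lamL t).trans
    (ht.lift (Term.lam A') fun _ _ => Step.lamR A')

theorem Steps.app {t t' u u' : Term C} (ht : Steps R t t') (hu : Steps R u u') :
    Steps R (app t u) (app t' u') :=
  (ht.lift (Term.app · u) fun _ _ => Step.appL u).trans
    (hu.lift (Term.app t') fun _ _ => Step.appR t')

theorem Steps.subst (θ : ℕ → Term C) {t u : Term C} (h : Steps R t u) :
    Steps R (subst θ t) (subst θ u) :=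
  h.lift (Term.subst θ) fun _ _ => Step.subst θ

/-- A variable may occur several times or not at all, so even one step in `θ` becomes a sequence of
steps. -/
theorem Steps.subst_left {θ σ : ℕ → Term C} (h : ∀ i, Steps R (θ i) (σ i)) (t : Term C) :
    Steps R (Term.subst θ t) (Term.subst σ t) := by
  have hup : ∀ {θ σ : ℕ → Term C}, (∀ i, Steps R (θ i) (σ i)) →
      ∀ i, Steps R (up θ i) (up σ i) := by
    intro θ σ h i
    cases i with
    | zero => exact .refl
    | succ i =>
      simp only [up, rename_eq_subst]
      exact (h i).subst _
  induction t generalizing θ σ with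
  | const c => exact .refl
  | var i => exact h i
  | sort s => exact .refl
  | pi A B ihA ihB => exact (ihA h).pi (ihB (hup h))
  | lam A B ihA ihB => exact (ihA h).lam (ihB (hup h))
  | app A B ihA ihB => exact (ihA h).app (ihB h)

theorem Steps.conv {t u : Term C} (h : Steps R t u) : Conv R t u := by
  induction h with
  | refl => exact .refl _
  | tail _ h ih => exact .trans _ _ _ ih (.rel _ _ h)

theorem Conv.map (f : Term C → Term C) (hf : ∀ t u, Step R t u → Step R (f t) (f u))
    {t u : Term C} (h : Conv R t u) : Conv R (f t) (f u) := by
  induction h with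
  | rel _ _ h => exact .rel _ _ (hf _ _ h)
  | refl => exact .refl _
  | symm _ _ _ ih => exact .symm _ _ ih
  | trans _ _ _ _ _ ih₁ ih₂ => exact .trans _ _ _ ih₁ ih₂

theorem Conv.subst (θ : ℕ → Term C) {t u : Term C} (h : Conv R t u) :
    Conv R (subst θ t) (subst θ u) :=
  h.map _ fun _ _ => Step.subst θ

theorem Conv.rename (ξ : ℕ → ℕ) {t u : Term C} (h : Conv R t u) :
    Conv R (rename ξ t) (rename ξ u) := by
  rw [rename_eq_subst, rename_eq_subst]
  exact h.subst _

end Reduction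

/-! # Orthogonal sets of rules -/

namespace Term

variable {C : Type*}

/-- The head of the term is a constant. -/
def headConst : Term C → Bool
  | const _ => true
  | app p _ => headConst p
  | _ => false

/-- The algebraic terms: built from variables and from constants applied to algebraic terms. -/
def isPat : Term C → Bool
  | const _ => true
  | var _ => true
  | app p q => headConst p && isPat p && isPat q
  | _ => false

/-- The variables of an algebraic term, from left to right. -/
def patVars : Term C → List ℕ
  | var i => [i]
  | app p q => patVars p ++ patVars q
  | _ => []

/-- A sufficient condition for two algebraic terms to have no common instance. -/
def clash [DecidableEq C] : Term C → Term C → Bool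
  | const c, const d => decide (c ≠ d)
  | const _, app _ _ => true
  | app _ _, const _ => true
  | app p q, app p' q' => clash p p' || clash q q'
  | _, _ => false

/-- No subterm other than a variable has a common instance with a left-hand side. -/
def safe [DecidableEq C] (L : List (Rule C)) : Term C → Bool
  | const c => L.all fun ρ => clash (const c) ρ.lhs
  | app p q => (L.all fun ρ => clash (app p q) ρ.lhs) && safe L p && safe L q
  | _ => true

/-- No proper subterm other than a variable has a common instance with a left-hand side. -/
def argsSafe [DecidableEq C] (L : List (Rule C)) : Term C → Bool
  | app p q => safe L p && safe L q
  | _ => true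

theorem clash_sound [DecidableEq C] (p : Term C) : ∀ (q : Term C) (θ σ : ℕ → Term C),
    clash p q = true → subst θ p ≠ subst σ q := by
  induction p with
  | const c => intro q θ σ h; cases q <;> simp_all [clash, subst]
  | app p q ihp ihq =>
    intro q' θ σ h
    cases q' with
    | app a b =>
      simp only [clash, Bool.or_eq_true] at h
      simp only [subst, ne_eq, app.injEq, not_and_or]
      exact h.imp (ihp _ _ _) (ihq _ _ _)
    | _ => simp_all [clash, subst]
  | _ => intro q θ σ h; simp [clash] at h

theorem headConst_subst {p : Term C} (h : headConst p = true) (θ : ℕ → Term C) :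
    headConst (subst θ p) = true := by
  induction p <;> simp_all [headConst, subst]

theorem headConst_apps (t : Term C) (us : List (Term C)) (h : headConst t = true) :
    headConst (apps t us) = true := by
  induction us generalizing t with
  | nil => exact h
  | cons u us ih => exact ih _ h

theorem patVars_subst_congr {p : Term C} (hp : isPat p = true) {θ σ : ℕ → Term C} :
    (∀ i ∈ patVars p, θ i = σ i) → subst θ p = subst σ p := by
  induction p with
  | const c => intros; rfl
  | var i => intro h; exact h i (by simp [patVars])
  | app p q ihp ihq =>
    simp only [isPat, Bool.and_eq_true] at hp
    intro h
    simp only [patVars, List.mem_append] at h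
    simp only [subst, ihp hp.1.2 fun i hi => h i (.inl hi), ihq hp.2 fun i hi => h i (.inr hi)]
  | _ => simp [isPat] at hp

/-- Matching is deterministic: an instance determines the values of the pattern variables. Below
binders `patVars` collects nothing, so no assumption on `p` is needed. -/
theorem patVars_subst_inj {p : Term C} {θ σ : ℕ → Term C} :
    subst θ p = subst σ p → ∀ i ∈ patVars p, θ i = σ i := by
  induction p with
  | var i => intro h j hj; simp only [patVars, List.mem_singleton] at hj; subst hj; exact h
  | app p q ihp ihq =>
    intro h i hi
    simp only [subst, app.injEq] at h
    simp only [patVars, List.mem_append] at hi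
    exact hi.elim (ihp h.1 i) (ihq h.2 i)
  | _ => intro _ i hi; simp [patVars] at hi

theorem sizeOf_le_of_mem_patVars {p : Term C} (θ : ℕ → Term C) {i : ℕ} :
    i ∈ patVars p → sizeOf (θ i) ≤ sizeOf (subst θ p) := by
  induction p with
  | var j => intro h; simp only [patVars, List.mem_singleton] at h; subst h; exact le_rfl
  | app p q ihp ihq =>
    intro h
    simp only [patVars, List.mem_append] at h
    simp only [subst, app.sizeOf_spec]
    rcases h with h | h
    · have := ihp h; omega
    · have := ihq h; omega
  | _ => intro h; simp [patVars] at h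

/-- A term headed by a constant is not a variable, so the values of its variables are proper
subterms of the instance. The induction of `Par.diamond` decreases by this. -/
theorem sizeOf_lt_of_mem_patVars {p : Term C} (hp : headConst p = true) (θ : ℕ → Term C) {i : ℕ}
    (h : i ∈ patVars p) : sizeOf (θ i) < sizeOf (subst θ p) := by
  cases p with
  | app p q =>
    simp only [patVars, List.mem_append] at h
    simp only [subst, app.sizeOf_spec]
    rcases h with h | h
    · have := sizeOf_le_of_mem_patVars θ h; omega
    · have := sizeOf_le_of_mem_patVars θ h; omega
  | const c => simp [patVars] at h
  | _ => simp [headConst] at hp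

end Term

/-- A list of left-linear rules with algebraic left-hand sides and without critical pairs. -/
structure Orthogonal {C : Type*} [DecidableEq C] (L : List (Rule C)) : Prop where
  pat : ∀ ρ ∈ L, isPat ρ.lhs = true
  linear : ∀ ρ ∈ L, (patVars ρ.lhs).Nodup
  vars : ∀ ρ ∈ L, ∃ n, ρ.rhs.FreeBelow n ∧ ∀ i < n, i ∈ patVars ρ.lhs
  inner : ∀ ρ ∈ L, argsSafe L ρ.lhs = true
  outer : ∀ ρ ∈ L, ∀ ρ' ∈ L, ρ = ρ' ∨ clash ρ.lhs ρ'.lhs = true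

theorem Rule.headConst_lhs {C : Type*} (ρ : Rule C) : headConst ρ.lhs = true :=
  headConst_apps _ _ rfl

theorem Rule.headConst_of_eq {C : Type*} {ρ : Rule C} {θ : ℕ → Term C} {t : Term C}
    (h : t = subst θ ρ.lhs) : headConst t = true :=
  h ▸ headConst_subst ρ.headConst_lhs θ

/-! # Parallel reduction -/

/-- Simultaneous contraction of some of the redexes of a term. -/
inductive Par {C : Type*} (R : Set (Rule C)) : Term C → Term C → Prop
  | const (c) : Par R (const c) (const c)
  | var (i) : Par R (var i) (var i)
  | sort (s) : Par R (sort s) (sort s)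
  | pi {A A' B B'} : Par R A A' → Par R B B' → Par R (pi A B) (pi A' B')
  | lam {A A' t t'} : Par R A A' → Par R t t' → Par R (lam A t) (lam A' t')
  | app {t t' u u'} : Par R t t' → Par R u u' → Par R (app t u) (app t' u')
  | beta (A) {t t' u u'} : Par R t t' → Par R u u' → Par R (app (lam A t) u) (inst u' t')
  | rule {ρ t u} {θ θ' : ℕ → Term C} : ρ ∈ R → t = subst θ ρ.lhs → u = subst θ' ρ.rhs →
      (∀ i, Par R (θ i) (θ' i)) → Par R t u

section Parallel

variable {C : Type*} {R : Set (Rule C)}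

open Relation

theorem Par.refl (t : Term C) : Par R t t := by
  induction t with
  | const c => exact .const c
  | var i => exact .var i
  | sort s => exact .sort s
  | pi _ _ h₁ h₂ => exact .pi h₁ h₂
  | lam _ _ h₁ h₂ => exact .lam h₁ h₂
  | app _ _ h₁ h₂ => exact .app h₁ h₂

theorem Par.rename {t t' : Term C} (h : Par R t t') :
    ∀ ξ : ℕ → ℕ, Par R (rename ξ t) (rename ξ t') := by
  induction h with
  | const c => exact fun _ => .const c
  | var i => exact fun _ => .var _
  | sort s => exact fun _ => .sort s
  | pi _ _ h₁ h₂ => exact fun ξ => .pi (h₁ ξ) (h₂ _)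
  | lam _ _ h₁ h₂ => exact fun ξ => .lam (h₁ ξ) (h₂ _)
  | app _ _ h₁ h₂ => exact fun ξ => .app (h₁ ξ) (h₂ ξ)
  | beta A _ _ h₁ h₂ =>
    intro ξ
    rw [rename_inst]
    exact .beta _ (h₁ _) (h₂ ξ)
  | rule hρ ht hu _ ih =>
    intro ξ
    rw [ht, hu, rename_subst, rename_subst]
    exact .rule hρ rfl rfl fun i => ih i ξ

theorem Par.up {θ θ' : ℕ → Term C} (h : ∀ i, Par R (θ i) (θ' i)) :
    ∀ i, Par R (up θ i) (up θ' i)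
  | 0 => .var 0
  | i + 1 => (h i).rename _

theorem Par.subst {t t' : Term C} (h : Par R t t') : ∀ {θ θ' : ℕ → Term C},
    (∀ i, Par R (θ i) (θ' i)) → Par R (subst θ t) (subst θ' t') := by
  induction h with
  | const c => exact fun _ => .const c
  | var i => exact fun h => h i
  | sort s => exact fun _ => .sort s
  | pi _ _ h₁ h₂ => exact fun h => .pi (h₁ h) (h₂ (Par.up h))
  | lam _ _ h₁ h₂ => exact fun h => .lam (h₁ h) (h₂ (Par.up h))
  | app _ _ h₁ h₂ => exact fun h => .app (h₁ h) (h₂ h)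
  | beta A _ _ h₁ h₂ =>
    intro θ θ' h
    rw [subst_inst]
    exact .beta _ (h₁ (Par.up h)) (h₂ h)
  | rule hρ ht hu _ ih =>
    intro θ θ' h
    rw [ht, hu, subst_subst, subst_subst]
    exact .rule hρ rfl rfl fun i => ih i h

theorem Par.inst {t t' u u' : Term C} (ht : Par R t t') (hu : Par R u u') :
    Par R (inst u t) (inst u' t') := by
  refine ht.subst fun i => ?_
  cases i with
  | zero => exact hu
  | succ i => exact .var i

theorem Compat.par {r : Term C → Term C → Prop} (hr : ∀ t u, r t u → Par R t u) {t u : Term C}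
    (h : Compat r t u) : Par R t u := by
  induction h with
  | root h => exact hr _ _ h
  | piL _ ih => exact .pi ih (.refl _)
  | piR _ ih => exact .pi (.refl _) ih
  | lamL _ ih => exact .lam ih (.refl _)
  | lamR _ ih => exact .lam (.refl _) ih
  | appL _ ih => exact .app ih (.refl _)
  | appR _ ih => exact .app (.refl _) ih

theorem Step.par {t u : Term C} (h : Step R t u) : Par R t u := by
  rcases h with h | h
  · refine h.par ?_
    rintro _ _ ⟨A, t, u⟩
    exact .beta _ (.refl _) (.refl _)
  · refine h.par ?_
    rintro _ _ ⟨hρ, θ⟩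
    exact .rule hρ rfl rfl fun _ => .refl _

theorem Par.steps {t u : Term C} (h : Par R t u) : Steps R t u := by
  induction h with
  | const c => exact .refl
  | var i => exact .refl
  | sort s => exact .refl
  | pi _ _ h₁ h₂ => exact h₁.pi h₂
  | lam _ _ h₁ h₂ => exact h₁.lam h₂
  | app _ _ h₁ h₂ => exact h₁.app h₂
  | beta A _ _ h₁ h₂ => exact ((Steps.lam .refl h₁).app h₂).tail (.inl (.root (.beta _ _ _)))
  | rule hρ ht hu _ ih =>
    rw [ht, hu]
    exact .head (.inr (.root (.rule hρ _))) (Steps.subst_left ih _)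

/-- Parallel reduction lies between one step and many steps. -/
theorem reflTransGen_par : ReflTransGen (Par R) = Steps R := by
  refine funext fun t => funext fun u => propext ⟨fun h => ?_, fun h => ?_⟩
  · induction h with
    | refl => exact .refl
    | tail _ h ih => exact ih.trans h.steps
  · induction h with
    | refl => exact .refl
    | tail _ h ih => exact ih.tail h.par

/-- Every left-hand side has a constant as head, so a product is never itself a redex. -/
theorem Par.of_pi {A B v : Term C} (h : Par R (Term.pi A B) v) :
    ∃ A' B', v = .pi A' B' ∧ Par R A A' ∧ Par R B B' := by
  cases h with
  | pi h₁ h₂ => exact ⟨_, _, rfl, h₁, h₂⟩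
  | rule hρ ht _ _ =>
    exact absurd (Rule.headConst_of_eq ht) (by simp [headConst])

theorem Steps.of_pi {A B v : Term C} (h : Steps R (Term.pi A B) v) :
    ∃ A' B', v = .pi A' B' ∧ Steps R A A' ∧ Steps R B B' := by
  induction h with
  | refl => exact ⟨A, B, rfl, .refl, .refl⟩
  | tail _ h ih =>
    obtain ⟨A₁, B₁, rfl, h₁, h₂⟩ := ih
    obtain ⟨A₂, B₂, rfl, h₃, h₄⟩ := h.par.of_pi
    exact ⟨A₂, B₂, rfl, h₁.trans h₃.steps, h₂.trans h₄.steps⟩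

/-! ### Diamond property and confluence for orthogonal rules -/

variable [DecidableEq C] {L : List (Rule C)}

/-- A parallel reduction from an instance of a term without overlaps takes place below its
variables. -/
theorem Par.of_safe (hR : ∀ ρ ∈ R, ρ ∈ L) {p : Term C} {θ : ℕ → Term C} :
    ∀ {v}, isPat p = true → (patVars p).Nodup → safe L p = true → Par R (Term.subst θ p) v →
    ∃ θ', v = Term.subst θ' p ∧ ∀ i ∈ patVars p, Par R (θ i) (θ' i) := by
  induction p with
  | const c =>
    intro v _ _ hs h
    refine ⟨θ, ?_, by simp [patVars]⟩
    generalize ht : Term.subst θ (.const c) = t at h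
    cases h with
    | rule hρ h₁ _ _ =>
      rw [safe, List.all_eq_true] at hs
      exact absurd (ht.trans h₁) (clash_sound _ _ _ _ (hs _ (hR _ hρ)))
    | const => rfl
    | _ => cases ht
  | var i =>
    intro v _ _ _ h
    refine ⟨fun _ => v, rfl, ?_⟩
    intro j hj
    simp only [patVars, List.mem_singleton] at hj
    subst hj
    exact h
  | app p q ihp ihq =>
    intro v hp hl hs h
    simp only [isPat, Bool.and_eq_true] at hp
    simp only [safe, Bool.and_eq_true, List.all_eq_true] at hs
    rw [patVars, List.nodup_append] at hl
    generalize ht : Term.subst θ (.app p q) = t at h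
    cases h with
    | rule hρ h₁ _ _ =>
      exact absurd (ht.trans h₁) (clash_sound _ _ _ _ (hs.1.1 _ (hR _ hρ)))
    -- The function part of a pattern application is headed by a constant, so no instance of it is
    -- an abstraction.
    | beta A _ _ =>
      simp only [Term.subst, app.injEq] at ht
      have := headConst_subst hp.1.1 θ
      rw [ht.1] at this
      simp [headConst] at this
    | app h₁ h₂ =>
      simp only [Term.subst, app.injEq] at ht
      obtain ⟨rfl, rfl⟩ := ht
      obtain ⟨θ₁, rfl, e₁⟩ := ihp hp.1.2 hl.1 hs.1.2 h₁
      obtain ⟨θ₂, rfl, e₂⟩ := ihq hp.2 hl.2.1 hs.2 h₂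
      -- By left-linearity the two parts share no variable, so the substitutions obtained for them
      -- can be merged.
      refine ⟨fun i => if i ∈ patVars p then θ₁ i else θ₂ i, ?_, ?_⟩
      · rw [Term.subst]
        congr 1
        · exact patVars_subst_congr hp.1.2 fun i hi => by simp [hi]
        · refine patVars_subst_congr hp.2 fun i hi => ?_
          have : i ∉ patVars p := fun h => hl.2.2 i h i hi rfl
          simp [this]
      · intro i hi
        by_cases hip : i ∈ patVars p
        · simpa [hip] using e₁ i hip
        · simp only [patVars, List.mem_append] at hi
          simpa [hip] using e₂ i (hi.resolve_left hip)
    | _ => cases ht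
  | _ => intro v hp; simp [isPat] at hp

/-- A parallel reduction from an instance of a left-hand side either contracts that instance or
takes place below its variables. -/
theorem Par.of_lhs (hL : Orthogonal L) (hR : ∀ ρ ∈ R, ρ ∈ L) {ρ : Rule C} (hρ : ρ ∈ R)
    {θ : ℕ → Term C} {v : Term C} (h : Par R (Term.subst θ ρ.lhs) v) :
    ∃ θ', (∀ i ∈ patVars ρ.lhs, Par R (θ i) (θ' i)) ∧
      (v = Term.subst θ' ρ.lhs ∨ v = Term.subst θ' ρ.rhs) := by
  have hp := hL.pat ρ (hR ρ hρ)
  have hl := hL.linear ρ (hR ρ hρ)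
  have hs := hL.inner ρ (hR ρ hρ)
  -- If the root is contracted, absence of overlaps forces the contracting rule to be `ρ` itself,
  -- with the same matching. Otherwise only the shape of the left-hand side matters, and the
  -- reduction splits along it.
  by_cases hroot : ∃ ρ' ∈ R, ∃ σ σ' : ℕ → Term C, Term.subst θ ρ.lhs = Term.subst σ ρ'.lhs ∧
      v = Term.subst σ' ρ'.rhs ∧ ∀ i, Par R (σ i) (σ' i)
  · obtain ⟨ρ', hρ', σ, σ', e₁, e₂, hσ⟩ := hroot
    rcases hL.outer ρ (hR ρ hρ) ρ' (hR ρ' hρ') with rfl | hc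
    · refine ⟨σ', fun i hi => ?_, .inr e₂⟩
      rw [patVars_subst_inj e₁ i hi]
      exact hσ i
    · exact absurd e₁ (clash_sound _ _ _ _ hc)
  have hh := ρ.headConst_lhs
  generalize ρ.lhs = l at *
  cases l with
  | const c =>
    refine ⟨θ, by simp [patVars], .inl ?_⟩
    generalize ht : Term.subst θ (.const c) = t at h hroot
    cases h with
    | rule hρ' h₁ h₂ h₃ => exact absurd ⟨_, hρ', _, _, h₁, h₂, h₃⟩ hroot
    | const => rfl
    | _ => cases ht
  | app p q =>
    have hp' := hp
    simp only [isPat, Bool.and_eq_true] at hp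
    simp only [argsSafe, Bool.and_eq_true] at hs
    rw [patVars, List.nodup_append] at hl
    generalize ht : Term.subst θ (.app p q) = t at h hroot
    cases h with
    | rule hρ' h₁ h₂ h₃ => exact absurd ⟨_, hρ', _, _, h₁, h₂, h₃⟩ hroot
    | beta A _ _ =>
      simp only [Term.subst, app.injEq] at ht
      have := headConst_subst hp.1.1 θ
      rw [ht.1] at this
      simp [headConst] at this
    | app h₁ h₂ =>
      simp only [Term.subst, app.injEq] at ht
      obtain ⟨rfl, rfl⟩ := ht
      obtain ⟨θ₁, rfl, e₁⟩ := h₁.of_safe hR hp.1.2 hl.1 hs.1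
      obtain ⟨θ₂, rfl, e₂⟩ := h₂.of_safe hR hp.2 hl.2.1 hs.2
      refine ⟨fun i => if i ∈ patVars p then θ₁ i else θ₂ i, ?_, .inl ?_⟩
      · intro i hi
        by_cases hip : i ∈ patVars p
        · simpa [hip] using e₁ i hip
        · simp only [patVars, List.mem_append] at hi
          simpa [hip] using e₂ i (hi.resolve_left hip)
      · rw [Term.subst]
        congr 1
        · exact patVars_subst_congr hp.1.2 fun i hi => by simp [hi]
        · refine patVars_subst_congr hp.2 fun i hi => ?_
          have : i ∉ patVars p := fun h => hl.2.2 i h i hi rfl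
          simp [this]
    | _ => cases ht
  | _ => simp [headConst] at hh

/-- Each reduct is an instance of the left-hand side or of the right-hand side of `ρ`, with reduced
values of the variables. These values are smaller than `t`, hence can be joined; contracting the
redex where it is still present leads both sides to one instance of the right-hand side. -/
theorem Par.join_of_lhs (hL : Orthogonal L) (hR : ∀ ρ ∈ R, ρ ∈ L) {ρ : Rule C} (hρ : ρ ∈ R)
    {θ : ℕ → Term C} {t u v : Term C} (ht : t = Term.subst θ ρ.lhs)
    (ih : ∀ t', sizeOf t' < sizeOf t → ∀ u v, Par R t' u → Par R t' v →
      ∃ w, Par R u w ∧ Par R v w)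
    (hu : Par R t u) (hv : Par R t v) : ∃ w, Par R u w ∧ Par R v w := by
  subst ht
  obtain ⟨θ₁, h₁, hu⟩ := hu.of_lhs hL hR hρ
  obtain ⟨θ₂, h₂, hv⟩ := hv.of_lhs hL hR hρ
  -- Outside the pattern variables the value is irrelevant; `θ i` is a default.
  have hw : ∀ i, ∃ w, i ∈ patVars ρ.lhs → Par R (θ₁ i) w ∧ Par R (θ₂ i) w := by
    intro i
    by_cases hi : i ∈ patVars ρ.lhs
    · obtain ⟨w, hw⟩ := ih _ (sizeOf_lt_of_mem_patVars ρ.headConst_lhs θ hi) _ _ (h₁ i hi) (h₂ i hi)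
      exact ⟨w, fun _ => hw⟩
    · exact ⟨θ i, fun h => absurd h hi⟩
  choose w hw using hw
  have key : ∀ (σ : ℕ → Term C) (x : Term C), (∀ i ∈ patVars ρ.lhs, Par R (σ i) (w i)) →
      (x = Term.subst σ ρ.lhs ∨ x = Term.subst σ ρ.rhs) → Par R x (Term.subst w ρ.rhs) := by
    intro σ x hσ hx
    obtain ⟨n, hn, hi⟩ := hL.vars ρ (hR ρ hρ)
    -- The `rule` constructor of `Par` asks for a reduction at every index, so `σ` is replaced by
    -- `w` outside the pattern variables. Neither side of the rule sees the change.
    let τ : ℕ → Term C := fun i => if i ∈ patVars ρ.lhs then σ i else w i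
    have hτ : ∀ i, Par R (τ i) (w i) := by
      intro i
      by_cases h : i ∈ patVars ρ.lhs
      · simpa [τ, h] using hσ i h
      · simpa [τ, h] using Par.refl _
    have hl : Term.subst σ ρ.lhs = Term.subst τ ρ.lhs :=
      patVars_subst_congr (hL.pat ρ (hR ρ hρ)) fun i h => by simp [τ, h]
    have hr : Term.subst σ ρ.rhs = Term.subst τ ρ.rhs :=
      subst_congr hn fun i h => by simp [τ, hi i h]
    rcases hx with rfl | rfl
    · exact .rule hρ hl rfl hτ
    · rw [hr]
      exact (Par.refl _).subst hτ
  exact ⟨_, key θ₁ u (fun i hi => (hw i hi).1) hu, key θ₂ v (fun i hi => (hw i hi).2) hv⟩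

/-- The induction is on the size of the term, because contracting a rule reduces the values of its
variables, which may lie deep in the term. All peaks involving a rule at the root go to
`join_of_lhs`. -/
theorem Par.diamond (hL : Orthogonal L) (hR : ∀ ρ ∈ R, ρ ∈ L) (t : Term C) :
    ∀ u v, Par R t u → Par R t v → ∃ w, Par R u w ∧ Par R v w := by
  induction hn : sizeOf t using Nat.strong_induction_on generalizing t with
  | _ n ih =>
  subst hn
  replace ih : ∀ t', sizeOf t' < sizeOf t → ∀ u v, Par R t' u → Par R t' v →
      ∃ w, Par R u w ∧ Par R v w := fun t' ht' => ih _ ht' t' rfl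
  intro u v hu hv
  have hu' := hu
  have hv' := hv
  cases hu with
  | rule hρ ht _ _ => exact join_of_lhs hL hR hρ ht ih hu' hv'
  | const c =>
    cases hv with
    | rule hρ ht _ _ => exact join_of_lhs hL hR hρ ht ih hu' hv'
    | const => exact ⟨_, .refl _, .refl _⟩
  | var i =>
    cases hv with
    | rule hρ ht _ _ => exact join_of_lhs hL hR hρ ht ih hu' hv'
    | var => exact ⟨_, .refl _, .refl _⟩
  | sort i =>
    cases hv with
    | rule hρ ht _ _ => exact join_of_lhs hL hR hρ ht ih hu' hv'
    | sort => exact ⟨_, .refl _, .refl _⟩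
  | pi h₁ h₂ =>
    cases hv with
    | rule hρ ht _ _ => exact join_of_lhs hL hR hρ ht ih hu' hv'
    | pi k₁ k₂ =>
      obtain ⟨w₁, a₁, b₁⟩ := ih _ (by simp only [pi.sizeOf_spec]; omega) _ _ h₁ k₁
      obtain ⟨w₂, a₂, b₂⟩ := ih _ (by simp only [pi.sizeOf_spec]; omega) _ _ h₂ k₂
      exact ⟨_, .pi a₁ a₂, .pi b₁ b₂⟩
  | lam h₁ h₂ =>
    cases hv with
    | rule hρ ht _ _ => exact join_of_lhs hL hR hρ ht ih hu' hv'
    | lam k₁ k₂ =>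
      obtain ⟨w₁, a₁, b₁⟩ := ih _ (by simp only [lam.sizeOf_spec]; omega) _ _ h₁ k₁
      obtain ⟨w₂, a₂, b₂⟩ := ih _ (by simp only [lam.sizeOf_spec]; omega) _ _ h₂ k₂
      exact ⟨_, .lam a₁ a₂, .lam b₁ b₂⟩
  | app h₁ h₂ =>
    cases hv with
    | rule hρ ht _ _ => exact join_of_lhs hL hR hρ ht ih hu' hv'
    | app k₁ k₂ =>
      obtain ⟨w₁, a₁, b₁⟩ := ih _ (by simp only [app.sizeOf_spec]; omega) _ _ h₁ k₁
      obtain ⟨w₂, a₂, b₂⟩ := ih _ (by simp only [app.sizeOf_spec]; omega) _ _ h₂ k₂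
      exact ⟨_, .app a₁ a₂, .app b₁ b₂⟩
    | beta A k₁ k₂ =>
      obtain ⟨w₂, a₂, b₂⟩ := ih _ (by simp only [app.sizeOf_spec]; omega) _ _ h₂ k₂
      -- An abstraction is not headed by a constant, so no rule contracts it: it reduces to an
      -- abstraction, and the β-redex survives.
      cases h₁ with
      | rule hρ ht _ _ =>
        exact absurd (Rule.headConst_of_eq ht) (by simp [headConst])
      | lam h₀ h₁ =>
        obtain ⟨w₁, a₁, b₁⟩ := ih _
          (by simp only [app.sizeOf_spec, lam.sizeOf_spec]; omega) _ _ h₁ k₁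
        exact ⟨_, .beta _ a₁ a₂, b₁.inst b₂⟩
  | beta A h₁ h₂ =>
    cases hv with
    | rule hρ ht _ _ => exact join_of_lhs hL hR hρ ht ih hu' hv'
    | app k₁ k₂ =>
      obtain ⟨w₂, a₂, b₂⟩ := ih _ (by simp only [app.sizeOf_spec]; omega) _ _ h₂ k₂
      cases k₁ with
      | rule hρ ht _ _ =>
        exact absurd (Rule.headConst_of_eq ht) (by simp [headConst])
      | lam k₀ k₁ =>
        obtain ⟨w₁, a₁, b₁⟩ := ih _
          (by simp only [app.sizeOf_spec, lam.sizeOf_spec]; omega) _ _ h₁ k₁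
        exact ⟨_, a₁.inst a₂, .beta _ b₁ b₂⟩
    | beta _ k₁ k₂ =>
      obtain ⟨w₂, a₂, b₂⟩ := ih _ (by simp only [app.sizeOf_spec]; omega) _ _ h₂ k₂
      obtain ⟨w₁, a₁, b₁⟩ := ih _
        (by simp only [app.sizeOf_spec, lam.sizeOf_spec]; omega) _ _ h₁ k₁
      exact ⟨_, a₁.inst a₂, b₁.inst b₂⟩

/-- An orthogonal set of rules is confluent together with β. -/
theorem Orthogonal.confluent (hL : Orthogonal L) (hR : ∀ ρ ∈ R, ρ ∈ L) {t u v : Term C}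
    (hu : Steps R t u) (hv : Steps R t v) : Join (Steps R) u v := by
  rw [← reflTransGen_par] at *
  refine church_rosser (fun a b c hb hc => ?_) hu hv
  obtain ⟨w, h₁, h₂⟩ := Par.diamond hL hR a b c hb hc
  exact ⟨w, .single h₁, .single h₂⟩

theorem Orthogonal.join_of_conv (hL : Orthogonal L) (hR : ∀ ρ ∈ R, ρ ∈ L) {t u : Term C}
    (h : Conv R t u) : Join (Steps R) t u := by
  induction h with
  | rel _ _ h => exact ⟨_, .single h, .refl⟩
  | refl => exact ⟨_, .refl, .refl⟩
  | symm _ _ _ ih => exact let ⟨w, h₁, h₂⟩ := ih; ⟨w, h₂, h₁⟩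
  | trans _ _ _ _ _ ih₁ ih₂ =>
    obtain ⟨a, h₁, h₂⟩ := ih₁
    obtain ⟨b, h₃, h₄⟩ := ih₂
    obtain ⟨w, h₅, h₆⟩ := hL.confluent hR h₂ h₃
    exact ⟨w, h₁.trans h₅, h₄.trans h₆⟩

/-- A common reduct of two products is a product, obtained componentwise. -/
theorem Orthogonal.pi_inj (hL : Orthogonal L) (hR : ∀ ρ ∈ R, ρ ∈ L) {A A' B B' : Term C}
    (h : Conv R (pi A B) (pi A' B')) : Conv R A A' ∧ Conv R B B' := by
  obtain ⟨w, h₁, h₂⟩ := hL.join_of_conv hR h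
  obtain ⟨A₁, B₁, rfl, a₁, b₁⟩ := h₁.of_pi
  obtain ⟨A₂, B₂, e, a₂, b₂⟩ := h₂.of_pi
  cases e
  exact ⟨.trans _ _ _ a₁.conv (.symm _ _ a₂.conv), .trans _ _ _ b₁.conv (.symm _ _ b₂.conv)⟩

theorem Steps.of_safe (hR : ∀ ρ ∈ R, ρ ∈ L) {p v : Term C} {θ : ℕ → Term C} (hp : isPat p = true)
    (hl : (patVars p).Nodup) (hs : Term.safe L p = true) (h : Steps R (Term.subst θ p) v) :
    ∃ θ', v = Term.subst θ' p ∧ ∀ i ∈ patVars p, Steps R (θ i) (θ' i) := by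
  induction h with
  | refl => exact ⟨θ, rfl, fun _ _ => .refl⟩
  | tail _ h ih =>
    obtain ⟨θ₁, rfl, h₁⟩ := ih
    obtain ⟨θ₂, rfl, h₂⟩ := h.par.of_safe hR hp hl hs
    exact ⟨θ₂, rfl, fun i hi => (h₁ i hi).trans (h₂ i hi).steps⟩

/-- Convertible instances of a term without overlaps have convertible arguments. -/
theorem Orthogonal.safe_inj (hL : Orthogonal L) (hR : ∀ ρ ∈ R, ρ ∈ L) {p : Term C}
    {θ σ : ℕ → Term C} (hp : isPat p = true) (hl : (patVars p).Nodup) (hs : Term.safe L p = true)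
    (h : Conv R (Term.subst θ p) (Term.subst σ p)) : ∀ i ∈ patVars p, Conv R (θ i) (σ i) := by
  obtain ⟨w, h₁, h₂⟩ := hL.join_of_conv hR h
  obtain ⟨θ₁, rfl, k₁⟩ := h₁.of_safe hR hp hl hs
  obtain ⟨θ₂, e, k₂⟩ := h₂.of_safe hR hp hl hs
  intro i hi
  have := (k₁ i hi).conv
  rw [patVars_subst_inj e i hi] at this
  exact .trans _ _ _ this (.symm _ _ (k₂ i hi).conv)

end Parallel

/-! # Reduction and declared constants -/

section Constants

variable {C : Type*}

theorem Term.consts_rename (t : Term C) : ∀ ξ : ℕ → ℕ, (rename ξ t).consts = t.consts := by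
  induction t <;> intro ξ <;> simp_all [rename, consts]

theorem Term.consts_subst_subset {D : Set C} (t : Term C) : ∀ {θ : ℕ → Term C},
    t.consts ⊆ D → (∀ i, (θ i).consts ⊆ D) → (subst θ t).consts ⊆ D := by
  have hup : ∀ {θ : ℕ → Term C}, (∀ i, (θ i).consts ⊆ D) → ∀ i, (up θ i).consts ⊆ D := by
    intro θ h i
    cases i with
    | zero => exact Set.empty_subset _
    | succ i => rw [up, consts_rename]; exact h i
  induction t with
  | const c => exact fun h _ => h
  | var i => exact fun _ h => h i
  | sort s => exact fun h _ => h
  | pi A B ihA ihB =>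
    intro θ h hθ
    have := Set.union_subset_iff.1 h
    exact Set.union_subset (ihA this.1 hθ) (ihB this.2 (hup hθ))
  | lam A B ihA ihB =>
    intro θ h hθ
    have := Set.union_subset_iff.1 h
    exact Set.union_subset (ihA this.1 hθ) (ihB this.2 (hup hθ))
  | app A B ihA ihB =>
    intro θ h hθ
    have := Set.union_subset_iff.1 h
    exact Set.union_subset (ihA this.1 hθ) (ihB this.2 hθ)

theorem Term.consts_subset_of_mem_patVars {p : Term C} (θ : ℕ → Term C) {i : ℕ} :
    i ∈ patVars p → (θ i).consts ⊆ (subst θ p).consts := by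
  induction p with
  | var j => intro h; simp only [patVars, List.mem_singleton] at h; subst h; exact subset_rfl
  | app p q ihp ihq =>
    intro h
    simp only [patVars, List.mem_append] at h
    rcases h with h | h
    · exact (ihp h).trans Set.subset_union_left
    · exact (ihq h).trans Set.subset_union_right
  | _ => intro h; simp [patVars] at h

theorem Compat.consts_subset {D : Set C} {r : Term C → Term C → Prop}
    (hr : ∀ t u, r t u → t.consts ⊆ D → u.consts ⊆ D) {t u : Term C} (h : Compat r t u) :
    t.consts ⊆ D → u.consts ⊆ D := by
  induction h with
  | root h => exact hr _ _ h
  | piL _ ih | lamL _ ih | appL _ ih =>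
    intro h
    have := Set.union_subset_iff.1 h
    exact Set.union_subset (ih this.1) this.2
  | piR _ ih | lamR _ ih | appR _ ih =>
    intro h
    have := Set.union_subset_iff.1 h
    exact Set.union_subset this.1 (ih this.2)

variable [DecidableEq C] {L : List (Rule C)}

/-- The variables of a right-hand side occur on the left, and its own constants are declared because
`T` is a system. -/
theorem Orthogonal.consts_subset_of_step (hL : Orthogonal L) (T : System C)
    (hR : ∀ ρ ∈ T.rules, ρ ∈ L) {t u : Term C} (h : Step T.rules t u) :
    t ∈ T.sig.terms → u ∈ T.sig.terms := by
  rcases h with h | h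
  · refine h.consts_subset ?_
    rintro _ _ ⟨A, t, u⟩ h
    have h₁ := Set.union_subset_iff.1 h
    have h₂ := Set.union_subset_iff.1 h₁.1
    refine consts_subst_subset _ h₂.2 fun i => ?_
    cases i with
    | zero => exact h₁.2
    | succ i => exact Set.empty_subset _
  · refine h.consts_subset ?_
    rintro _ _ ⟨hρ, θ⟩ h
    obtain ⟨n, hn, hi⟩ := hL.vars _ (hR _ hρ)
    -- Outside the variables of the rule, `θ` is arbitrary and may contain undeclared constants; it
    -- is replaced there by the identity.
    rw [subst_congr (σ := fun i => if i < n then θ i else .var i) hn fun i h => by simp [h]]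
    refine consts_subst_subset _ (T.rules_mem _ hρ).2 fun i => ?_
    by_cases h' : i < n
    · simpa [h'] using (consts_subset_of_mem_patVars θ (hi i h')).trans h
    · simp [h', consts]

theorem Orthogonal.confluentOn (hL : Orthogonal L) (T : System C) (hR : ∀ ρ ∈ T.rules, ρ ∈ L) :
    ConfluentOn (Step T.rules) T.sig.terms := by
  intro t _ u hu v _ h₁ h₂
  obtain ⟨w, h₃, h₄⟩ := hL.confluent hR h₁ h₂
  refine ⟨w, ?_, h₃, h₄⟩
  clear h₄
  induction h₃ with
  | refl => exact hu
  | tail _ h ih => exact hL.consts_subset_of_step T hR h ih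

end Constants

end LambdaPi

namespace LambdaPi

open Term

/-! # Typing -/

section Typing

variable {C : Type*} {S : Signature C} {R : Set (Rule C)}

/-- The context `Γ` is well-formed. -/
def Wf (S : Signature C) (R : Set (Rule C)) (Γ : Ctx C) : Prop := Derivable S R (.wf Γ)

theorem HasType.wf {Γ : Ctx C} {t A : Term C} (h : HasType S R Γ t A) : Wf S R Γ := by
  have key : ∀ {J : Judgement C}, Derivable S R J → ∀ Γ t A, J = .typ Γ t A → Wf S R Γ := by
    intro J h
    induction h with
    | empty | decl => intro _ _ _ e; cases e
    | sort h | const h | var h => intro _ _ _ e; cases e; exact h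
    | prod _ _ ih | abs _ _ _ ih | app _ _ ih | conv _ _ _ ih =>
      intro _ _ _ e; cases e; exact ih _ _ _ rfl
  exact key h _ _ _ rfl

theorem HasType.weaken_wf {Γ : Ctx C} {A : Term C} {s} (h : HasType S R Γ A (sort s)) :
    Wf S R (A :: Γ) := .decl h

/-- The hypothesis on `ξ` says that it sends each declaration of `Γ` to one of `Δ` whose type,
lifted to the whole context, is the renamed one. This precedes the substitution lemma, whose passage
under a binder weakens the values `θ i`. -/
theorem HasType.rename {Γ : Ctx C} {t A : Term C} (h : HasType S R Γ t A) :
    ∀ (Δ : Ctx C) (ξ : ℕ → ℕ), Wf S R Δ →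
    (∀ i B, Γ[i]? = some B → ∃ B', Δ[ξ i]? = some B' ∧
      rename (fun j => j + (ξ i + 1)) B' = rename ξ (rename (fun j => j + (i + 1)) B)) →
    HasType S R Δ (rename ξ t) (rename ξ A) := by
  have up : ∀ {Γ Δ : Ctx C} {ξ : ℕ → ℕ} (A : Term C),
      (∀ i B, Γ[i]? = some B → ∃ B', Δ[ξ i]? = some B' ∧
        Term.rename (fun j => j + (ξ i + 1)) B' =
          Term.rename ξ (Term.rename (fun j => j + (i + 1)) B)) →
      ∀ i B, (A :: Γ)[i]? = some B → ∃ B', (Term.rename ξ A :: Δ)[upRen ξ i]? = some B' ∧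
        Term.rename (fun j => j + (upRen ξ i + 1)) B' =
          Term.rename (upRen ξ) (Term.rename (fun j => j + (i + 1)) B) := by
    intro Γ Δ ξ A h i B hi
    cases i with
    | zero =>
      simp only [List.getElem?_cons_zero, Option.some.injEq] at hi
      subst hi
      refine ⟨_, rfl, ?_⟩
      simp only [rename_rename]
      rfl
    | succ i =>
      simp only [List.getElem?_cons_succ] at hi
      obtain ⟨B', h₁, h₂⟩ := h i B hi
      refine ⟨B', h₁, ?_⟩
      have := congrArg (Term.rename Nat.succ) h₂
      simp only [rename_rename] at this ⊢
      exact this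
  -- `Derivable` treats both judgement forms in one family, so the induction runs over all
  -- judgements and an equation selects the typing ones. The later inversions use the same device.
  have key : ∀ {J : Judgement C}, Derivable S R J → ∀ Γ t A, J = .typ Γ t A →
      ∀ (Δ : Ctx C) (ξ : ℕ → ℕ), Wf S R Δ →
      (∀ i B, Γ[i]? = some B → ∃ B', Δ[ξ i]? = some B' ∧
        Term.rename (fun j => j + (ξ i + 1)) B' =
          Term.rename ξ (Term.rename (fun j => j + (i + 1)) B)) →
      HasType S R Δ (Term.rename ξ t) (Term.rename ξ A) := by
    intro J h
    induction h with
    | empty | decl => intro _ _ _ e; cases e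
    | sort => intro _ _ _ e Δ ξ hΔ _; cases e; exact .sort hΔ
    | const _ hA hc =>
      intro _ _ _ e Δ ξ hΔ _
      cases e
      rw [(S.closed _ hc : Closed _).rename_eq]
      exact .const hΔ hA hc
    | var _ hi =>
      intro _ _ _ e Δ ξ hΔ h
      cases e
      obtain ⟨B', h₁, h₂⟩ := h _ _ hi
      rw [← h₂]
      exact .var hΔ h₁
    | prod _ _ ihA ihB =>
      intro _ _ _ e Δ ξ hΔ h
      cases e
      have hA := ihA _ _ _ rfl Δ ξ hΔ h
      exact .prod hA (ihB _ _ _ rfl _ _ hA.weaken_wf (up _ h))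
    | abs _ _ _ ihA ihB iht =>
      intro _ _ _ e Δ ξ hΔ h
      cases e
      have hA := ihA _ _ _ rfl Δ ξ hΔ h
      exact .abs hA (ihB _ _ _ rfl _ _ hA.weaken_wf (up _ h))
        (iht _ _ _ rfl _ _ hA.weaken_wf (up _ h))
    | app _ _ iht ihu =>
      intro _ _ _ e Δ ξ hΔ h
      cases e
      rw [rename_inst]
      exact .app (iht _ _ _ rfl Δ ξ hΔ h) (ihu _ _ _ rfl Δ ξ hΔ h)
    | conv _ _ hc iht ihB =>
      intro _ _ _ e Δ ξ hΔ h
      cases e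
      exact .conv (iht _ _ _ rfl Δ ξ hΔ h) (ihB _ _ _ rfl Δ ξ hΔ h) (hc.rename ξ)
  exact key h _ _ _ rfl

theorem HasType.weaken {Γ : Ctx C} {t A B : Term C} (h : HasType S R Γ t A)
    (hB : Wf S R (B :: Γ)) :
    HasType S R (B :: Γ) (Term.rename Nat.succ t) (Term.rename Nat.succ A) := by
  refine h.rename _ _ hB fun i D hi => ⟨D, hi, ?_⟩
  rw [rename_rename]
  rfl

theorem HasType.var_zero {Γ : Ctx C} {A : Term C} (h : Wf S R (A :: Γ)) :
    HasType S R (A :: Γ) (.var 0) (Term.rename Nat.succ A) :=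
  .var (i := 0) h rfl

theorem HasType.subst {Γ : Ctx C} {t A : Term C} (h : HasType S R Γ t A) :
    ∀ (Δ : Ctx C) (θ : ℕ → Term C), Wf S R Δ →
    (∀ i B, Γ[i]? = some B →
      HasType S R Δ (θ i) (subst θ (Term.rename (fun j => j + (i + 1)) B))) →
    HasType S R Δ (subst θ t) (subst θ A) := by
  have up : ∀ {Γ Δ : Ctx C} {θ : ℕ → Term C} (A : Term C), Wf S R (Term.subst θ A :: Δ) →
      (∀ i B, Γ[i]? = some B →
        HasType S R Δ (θ i) (Term.subst θ (Term.rename (fun j => j + (i + 1)) B))) →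
      ∀ i B, (A :: Γ)[i]? = some B → HasType S R (Term.subst θ A :: Δ) (up θ i)
        (Term.subst (up θ) (Term.rename (fun j => j + (i + 1)) B)) := by
    intro Γ Δ θ A hw h i B hi
    cases i with
    | zero =>
      simp only [List.getElem?_cons_zero, Option.some.injEq] at hi
      subst hi
      have := HasType.var_zero hw
      rw [rename_subst] at this
      rw [subst_rename]
      exact this
    | succ i =>
      simp only [List.getElem?_cons_succ] at hi
      have := (h i B hi).weaken hw
      rw [subst_rename, rename_subst] at this
      rw [subst_rename]
      exact this
  have key : ∀ {J : Judgement C}, Derivable S R J → ∀ Γ t A, J = .typ Γ t A →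
      ∀ (Δ : Ctx C) (θ : ℕ → Term C), Wf S R Δ →
      (∀ i B, Γ[i]? = some B →
        HasType S R Δ (θ i) (Term.subst θ (Term.rename (fun j => j + (i + 1)) B))) →
      HasType S R Δ (Term.subst θ t) (Term.subst θ A) := by
    intro J h
    induction h with
    | empty | decl => intro _ _ _ e; cases e
    | sort => intro _ _ _ e Δ θ hΔ _; cases e; exact .sort hΔ
    | const _ hA hc =>
      intro _ _ _ e Δ θ hΔ _
      cases e
      rw [(S.closed _ hc : Closed _).subst_eq]
      exact .const hΔ hA hc
    | var _ hi =>
      intro _ _ _ e Δ θ hΔ h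
      cases e
      exact h _ _ hi
    | prod _ _ ihA ihB =>
      intro _ _ _ e Δ θ hΔ h
      cases e
      have hA := ihA _ _ _ rfl Δ θ hΔ h
      exact .prod hA (ihB _ _ _ rfl _ _ hA.weaken_wf (up _ hA.weaken_wf h))
    | abs _ _ _ ihA ihB iht =>
      intro _ _ _ e Δ θ hΔ h
      cases e
      have hA := ihA _ _ _ rfl Δ θ hΔ h
      exact .abs hA (ihB _ _ _ rfl _ _ hA.weaken_wf (up _ hA.weaken_wf h))
        (iht _ _ _ rfl _ _ hA.weaken_wf (up _ hA.weaken_wf h))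
    | app _ _ iht ihu =>
      intro _ _ _ e Δ θ hΔ h
      cases e
      rw [subst_inst]
      exact .app (iht _ _ _ rfl Δ θ hΔ h) (ihu _ _ _ rfl Δ θ hΔ h)
    | conv _ _ hc iht ihB =>
      intro _ _ _ e Δ θ hΔ h
      cases e
      exact .conv (iht _ _ _ rfl Δ θ hΔ h) (ihB _ _ _ rfl Δ θ hΔ h) (hc.subst θ)
  exact key h _ _ _ rfl

theorem Wf.getElem? {Γ : Ctx C} (h : Wf S R Γ) {i : ℕ} {A : Term C} (hi : Γ[i]? = some A) :
    ∃ s, HasType S R Γ (Term.rename (fun j => j + (i + 1)) A) (sort s) := by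
  induction Γ generalizing i with
  | nil => simp at hi
  | cons B Γ ih =>
    have hw := h
    cases h with
    | decl h =>
    cases i with
    | zero =>
      simp only [List.getElem?_cons_zero, Option.some.injEq] at hi
      subst hi
      exact ⟨_, HasType.weaken h hw⟩
    | succ i =>
      obtain ⟨s, hs⟩ := ih (HasType.wf h) hi
      have := hs.weaken hw
      rw [rename_rename] at this
      exact ⟨s, this⟩

theorem HasType.inst {Γ : Ctx C} {A B t u : Term C} (ht : HasType S R (A :: Γ) t B)
    (hu : HasType S R Γ u A) : HasType S R Γ (inst u t) (inst u B) := by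
  refine ht.subst Γ _ hu.wf fun i D hi => ?_
  cases i with
  | zero =>
    simp only [List.getElem?_cons_zero, Option.some.injEq] at hi
    subst hi
    change HasType S R Γ u (Term.inst u (Term.rename Nat.succ A))
    rwa [inst_rename_succ]
  | succ i =>
    simp only [List.getElem?_cons_succ] at hi
    have := Derivable.var hu.wf hi
    rw [subst_rename]
    rwa [rename_eq_subst] at this

theorem HasType.weaken_nil {Γ : Ctx C} {A : Term C} {s} (h : HasType S R [] A (sort s))
    (hΓ : Wf S R Γ) (hA : A.Closed) : HasType S R Γ A (sort s) := by
  have := h.subst Γ .var hΓ (by simp)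
  rwa [hA.subst_eq] at this

/-! ### Inversion of typing -/

theorem HasType.of_pi {Γ : Ctx C} {A B D : Term C} (h : HasType S R Γ (pi A B) D) :
    ∃ s, HasType S R (A :: Γ) B (sort s) := by
  have key : ∀ {J : Judgement C}, Derivable S R J → ∀ Γ D, J = .typ Γ (pi A B) D →
      ∃ s, HasType S R (A :: Γ) B (.sort s) := by
    intro J h
    induction h with
    | prod _ hB => intro _ _ e; cases e; exact ⟨_, hB⟩
    | conv _ _ _ ih => intro _ _ e; cases e; exact ih _ _ rfl
    | _ => intro _ _ e; cases e
  exact key h _ _ rfl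

/-- A type is `KIND` or is typable by a sort. -/
theorem HasType.type_correct {Γ : Ctx C} {t A : Term C} (h : HasType S R Γ t A) :
    A = .sort .kind ∨ ∃ s, HasType S R Γ A (sort s) := by
  have key : ∀ {J : Judgement C}, Derivable S R J → ∀ Γ t A, J = .typ Γ t A →
      A = .sort .kind ∨ ∃ s, HasType S R Γ A (.sort s) := by
    intro J h
    induction h with
    | empty | decl => intro _ _ _ e; cases e
    | sort => intro _ _ _ e; cases e; exact .inl rfl
    | const hΓ hA hc =>
      intro _ _ _ e; cases e; exact .inr ⟨_, HasType.weaken_nil hA hΓ (S.closed _ hc)⟩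
    | var hΓ hi => intro _ _ _ e; cases e; exact .inr (Wf.getElem? hΓ hi)
    | @prod _ _ _ s _ hB ihA ihB =>
      intro _ _ _ e
      cases e
      cases s with
      | type => exact .inr ⟨_, .sort (HasType.wf ‹_›)⟩
      | kind => exact .inl rfl
    | abs hA hB _ => intro _ _ _ e; cases e; exact .inr ⟨_, .prod hA hB⟩
    | app _ hu iht _ =>
      intro _ _ _ e
      cases e
      rcases iht _ _ _ rfl with h | ⟨s, h⟩
      · cases h
      · obtain ⟨s, h⟩ := h.of_pi
        exact .inr ⟨s, h.inst hu⟩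
    | conv _ hB _ => intro _ _ _ e; cases e; exact .inr ⟨_, hB⟩
  exact key h _ _ _ rfl

/-- Only the application rule and the conversion rule can type an application, so the type is
determined up to conversion. -/
theorem HasType.of_app {Γ : Ctx C} {t u D : Term C} (h : HasType S R Γ (app t u) D) :
    ∃ A B, HasType S R Γ t (pi A B) ∧ HasType S R Γ u A ∧ Conv R (Term.inst u B) D := by
  have key : ∀ {J : Judgement C}, Derivable S R J → ∀ Γ D, J = .typ Γ (.app t u) D →
      ∃ A B, HasType S R Γ t (.pi A B) ∧ HasType S R Γ u A ∧ Conv R (Term.inst u B) D := by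
    intro J h
    induction h with
    | app ht hu => intro _ _ e; cases e; exact ⟨_, _, ht, hu, .refl _⟩
    | conv _ _ hc ih =>
      intro _ _ e
      cases e
      obtain ⟨A, B, h₁, h₂, h₃⟩ := ih _ _ rfl
      exact ⟨A, B, h₁, h₂, .trans _ _ _ h₃ hc⟩
    | _ => intro _ _ e; cases e
  exact key h _ _ rfl

theorem HasType.of_const {Γ : Ctx C} {c : C} {D : Term C} (h : HasType S R Γ (const c) D) :
    ∃ A, (c, A) ∈ S.decls ∧ Conv R A D := by
  have key : ∀ {J : Judgement C}, Derivable S R J → ∀ Γ D, J = .typ Γ (.const c) D →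
      ∃ A, (c, A) ∈ S.decls ∧ Conv R A D := by
    intro J h
    induction h with
    | const _ _ hc => intro _ _ e; cases e; exact ⟨_, hc, .refl _⟩
    | conv _ _ hc ih =>
      intro _ _ e
      cases e
      obtain ⟨A, h₁, h₂⟩ := ih _ _ rfl
      exact ⟨A, h₁, .trans _ _ _ h₂ hc⟩
    | _ => intro _ _ e; cases e
  exact key h _ _ rfl

/-- The types of a term with a constant as head are typable by a sort. -/
theorem HasType.exists_sort_of_headConst {Γ : Ctx C} {t D : Term C} (h : HasType S R Γ t D)
    (ht : headConst t = true) : ∃ s, HasType S R Γ D (sort s) := by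
  have key : ∀ {J : Judgement C}, Derivable S R J → ∀ Γ D, J = .typ Γ t D →
      ∃ s, HasType S R Γ D (.sort s) := by
    intro J h
    induction h with
    | const hΓ hA hc =>
      intro _ _ e; cases e; exact ⟨_, HasType.weaken_nil hA hΓ (S.closed _ hc)⟩
    | app hf hu =>
      intro _ _ e
      cases e
      rcases HasType.type_correct hf with hk | ⟨s, hp⟩
      · cases hk
      · obtain ⟨s, hB⟩ := hp.of_pi
        exact ⟨s, hB.inst hu⟩
    | conv _ hB _ => intro _ _ e; cases e; exact ⟨_, hB⟩
    | _ => intro _ _ e; cases e <;> simp [headConst] at ht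
  exact key h _ _ rfl

theorem HasType.arr {Γ : Ctx C} {A B : Term C} {s} (hA : HasType S R Γ A (sort .type))
    (hB : HasType S R Γ B (sort s)) : HasType S R Γ (arr A B) (sort s) :=
  .prod hA (hB.weaken hA.weaken_wf)

theorem HasType.app_arr {Γ : Ctx C} {A B t u : Term C} (ht : HasType S R Γ t (Term.arr A B))
    (hu : HasType S R Γ u A) : HasType S R Γ (app t u) B := by
  have := Derivable.app ht hu
  rwa [inst_rename_succ] at this

/-- All the types of `t` in `Γ` are convertible to `A`. -/
def TypesConv (S : Signature C) (R : Set (Rule C)) (Γ : Ctx C) (t A : Term C) : Prop :=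
  ∀ D, HasType S R Γ t D → Conv R A D

/-- Injectivity of products modulo conversion. -/
def PiInjective (R : Set (Rule C)) : Prop :=
  ∀ A B A' B' : Term C, Conv R (pi A B) (pi A' B') → Conv R A A' ∧ Conv R B B'

/-- `TypesConv` does not claim that the term is typable, so it propagates along a spine of arguments
without any typing of these arguments. -/
theorem TypesConv.app (hR : PiInjective R) {Γ : Ctx C} {t A B : Term C}
    (h : TypesConv S R Γ t (pi A B)) (u : Term C) : TypesConv S R Γ (app t u) (inst u B) := by
  intro D hD
  obtain ⟨A', B', h₁, _, h₃⟩ := hD.of_app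
  exact .trans _ _ _ ((hR _ _ _ _ (h _ h₁)).2.subst _) h₃

theorem TypesConv.app_arr (hR : PiInjective R) {Γ : Ctx C} {t A B : Term C}
    (h : TypesConv S R Γ t (arr A B)) (u : Term C) : TypesConv S R Γ (.app t u) B := by
  have := TypesConv.app hR h u
  rwa [inst_rename_succ] at this

theorem TypesConv.arg (hR : PiInjective R) {Γ : Ctx C} {t A B u D : Term C}
    (h : TypesConv S R Γ t (pi A B)) (hD : HasType S R Γ (.app t u) D) {s}
    (hA : HasType S R Γ A (sort s)) : HasType S R Γ u A := by
  obtain ⟨A', B', h₁, h₂, _⟩ := hD.of_app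
  exact .conv h₂ hA (.symm _ _ (hR _ _ _ _ (h _ h₁)).1)

theorem HasType.fun_part {Γ : Ctx C} {t u D : Term C} (h : HasType S R Γ (app t u) D) :
    ∃ D', HasType S R Γ t D' :=
  let ⟨_, _, h, _⟩ := h.of_app
  ⟨_, h⟩

/-- A term of the same type as `t` may replace `t`. -/
theorem TypesConv.transfer {Γ : Ctx C} {t r A D : Term C} (h : TypesConv S R Γ t A)
    (ht : headConst t = true) (hD : HasType S R Γ t D) (hr : HasType S R Γ r A) :
    HasType S R Γ r D :=
  let ⟨_, hs⟩ := hD.exists_sort_of_headConst ht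
  .conv hr hs (h D hD)

end Typing

end LambdaPi

namespace LambdaPi

open Term

/-! # The system U is orthogonal -/

/-- The declarations are listed in the order of the constructors, so the index recovers the
constant. This takes one case per constant instead of one per pair. -/
theorem USym.ctorIdx_injective : Function.Injective USym.ctorIdx := by
  have h (c : USym) : (U.decls.map Prod.fst)[c.ctorIdx]? = some c := by cases c <;> rfl
  intro a b hab
  exact Option.some.inj ((h a).symm.trans (hab ▸ h b))

instance : DecidableEq USym := fun _ _ => decidable_of_iff _ USym.ctorIdx_injective.eq_iff

namespace U

theorem orthogonal_rules : Orthogonal rules where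
  pat := by decide +kernel
  linear := by decide +kernel
  vars := by
    have h₁ : ∀ ρ ∈ rules, ρ.rhs.FreeBelow (patVars ρ.lhs).length := by
      simp [rules, FreeBelow, arr, rename, upRen, apps, bin, el, prf, ty, els, negneg, tI, tSet,
        tProp, Rule.lhs, patVars]
    have h₂ : ∀ ρ ∈ rules, ∀ i < (patVars ρ.lhs).length, i ∈ patVars ρ.lhs := by decide +kernel
    exact fun ρ hρ => ⟨_, h₁ ρ hρ, h₂ ρ hρ⟩
  inner := by decide +kernel
  outer := by
    -- Distinct rules are compared by position in the list, and `clash` is checked in both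
    -- directions since it is oriented; equality of rules need not be decided.
    have h : rules.Pairwise fun ρ ρ' =>
        clash ρ.lhs ρ'.lhs = true ∧ clash ρ'.lhs ρ.lhs = true := by decide +kernel
    intro ρ hρ ρ' hρ'
    let r : Rule USym → Rule USym → Prop := fun ρ ρ' =>
      ρ = ρ' ∨ (clash ρ.lhs ρ'.lhs = true ∧ clash ρ'.lhs ρ.lhs = true)
    have : Std.Symm r := ⟨fun _ _ h => h.imp Eq.symm And.symm⟩
    have : r ρ ρ' := List.Pairwise.forall_of_forall (R := r) (fun _ _ => .inl rfl)
      (h.imp fun h => .inr h) hρ hρ'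
    exact this.imp id And.left

theorem decls_inj {c : USym} {A B : Term USym} (hA : (c, A) ∈ decls) (hB : (c, B) ∈ decls) :
    A = B := by
  have h : (decls.map Prod.fst).Nodup := by decide +kernel
  have := List.inj_on_of_nodup_map h hA hB rfl
  exact congrArg Prod.snd this

/-- The declared type of a constant. -/
def declType (c : USym) : Term USym :=
  ((decls.find? fun d => decide (d.1 = c)).map Prod.snd).getD tType

/-- All constants are declared, so the default value in `declType` is never used. -/
theorem declType_mem (c : USym) : (c, declType c) ∈ decls := by
  cases c <;> simp [declType, decls]

theorem declType_eq {c : USym} {A : Term USym} (h : (c, A) ∈ decls) : declType c = A :=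
  decls_inj (declType_mem c) h

end U

theorem Term.subst_up_rename_succ {C : Type*} (σ : ℕ → Term C) (t : Term C) :
    subst (up σ) (rename Nat.succ t) = rename Nat.succ (subst σ t) := by
  simp only [subst_rename, rename_subst, up]

theorem Term.subst_single_rename_succ {C : Type*} (u t : Term C) :
    subst (single u) (rename Nat.succ t) = t :=
  inst_rename_succ u t

theorem Term.consts_arr {C : Type*} (A B : Term C) : (arr A B).consts = A.consts ∪ B.consts := by
  rw [arr, consts, consts_rename]

/-! # Typing in the fragments of U -/

section Fragment

open U

/-- The typing judgement of a system. -/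
abbrev System.HasType {C : Type*} (T : System C) (Γ : Ctx C) (t A : Term C) : Prop :=
  LambdaPi.HasType T.sig T.rules Γ t A

/-- Well-formedness of contexts in a system. -/
abbrev System.Wf {C : Type*} (T : System C) (Γ : Ctx C) : Prop := LambdaPi.Wf T.sig T.rules Γ

variable {T : System USym}

namespace System.IsFragment

theorem piInjective (hT : T.IsFragment U.system) : PiInjective T.rules := fun _ _ _ _ h =>
  orthogonal_rules.pi_inj (fun _ hρ => hT.rules_subset hρ) h

theorem mem_decls (hT : T.IsFragment U.system)
    {c : USym} (hc : c ∈ T.sig.dom) : (c, declType c) ∈ T.sig.decls := by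
  obtain ⟨B, hB⟩ := hc
  rwa [declType_eq (hT.sig_subset _ hB)]

theorem consts_subset (hT : T.IsFragment U.system)
    {c : USym} (hc : c ∈ T.sig.dom) : (declType c).consts ⊆ T.sig.dom :=
  hT.sig_consts _ (hT.mem_decls hc)

/-- A constant is usable only once its declared type is typable in the fragment. The lemmas below
establish this for each shape of declared type; the equations on `declType` are discharged by
computation. -/
theorem const_of_sort (hT : T.IsFragment U.system)
    {c : USym} {A : Term USym} {s} (hc : c ∈ T.sig.dom)
    (h : T.HasType [] A (sort s)) {Γ : Ctx USym} (hΓ : T.Wf Γ) (hA : declType c = A := by rfl) :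
    T.HasType Γ (const c) A :=
  .const hΓ h (hA ▸ hT.mem_decls hc)

theorem typesConv_const (hT : T.IsFragment U.system) (c : USym) (Γ : Ctx USym) :
    TypesConv T.sig T.rules Γ (const c) (declType c) := by
  intro D hD
  obtain ⟨B, hB, h⟩ := hD.of_const
  rwa [declType_eq (hT.sig_subset _ hB)]

theorem const_type (hT : T.IsFragment U.system)
    {c : USym} (hc : c ∈ T.sig.dom) {Γ : Ctx USym} (hΓ : T.Wf Γ)
    (hA : declType c = tType := by rfl) : T.HasType Γ (const c) tType :=
  hT.const_of_sort hc (.sort .empty) hΓ hA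

theorem const_arr_type (hT : T.IsFragment U.system)
    {c k : USym} (hc : c ∈ T.sig.dom) {Γ : Ctx USym} (hΓ : T.Wf Γ)
    (hA : declType c = arr (const k) tType := by rfl) (hk : declType k = tType := by rfl) :
    T.HasType Γ (const c) (arr (const k) tType) := by
  have h := hT.consts_subset hc
  simp only [hA, consts_arr, consts, Set.union_subset_iff, Set.singleton_subset_iff] at h
  exact hT.const_of_sort hc ((hT.const_type h.1 .empty hk).arr (.sort .empty)) hΓ hA

theorem const_const (hT : T.IsFragment U.system)
    {c k : USym} (hc : c ∈ T.sig.dom) {Γ : Ctx USym} (hΓ : T.Wf Γ)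
    (hA : declType c = const k := by rfl) (hk : declType k = tType := by rfl) :
    T.HasType Γ (const c) (const k) := by
  have h := hT.consts_subset hc
  simp only [hA, consts, Set.singleton_subset_iff] at h
  exact hT.const_of_sort hc (hT.const_type h .empty hk) hΓ hA

theorem const_arr (hT : T.IsFragment U.system)
    {c k k' : USym} (hc : c ∈ T.sig.dom) {Γ : Ctx USym} (hΓ : T.Wf Γ)
    (hA : declType c = arr (const k) (const k') := by rfl) (hk : declType k = tType := by rfl)
    (hk' : declType k' = tType := by rfl) :
    T.HasType Γ (const c) (arr (const k) (const k')) := by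
  have h := hT.consts_subset hc
  simp only [hA, consts_arr, consts, Set.union_subset_iff, Set.singleton_subset_iff] at h
  exact hT.const_of_sort hc
    ((hT.const_type h.1 .empty hk).arr (hT.const_type h.2 .empty hk')) hΓ hA

theorem const_arr_arr (hT : T.IsFragment U.system)
    {c k k' k'' : USym} (hc : c ∈ T.sig.dom) {Γ : Ctx USym} (hΓ : T.Wf Γ)
    (hA : declType c = arr (const k) (arr (const k') (const k'')) := by rfl)
    (hk : declType k = tType := by rfl) (hk' : declType k' = tType := by rfl)
    (hk'' : declType k'' = tType := by rfl) :
    T.HasType Γ (const c) (arr (const k) (arr (const k') (const k''))) := by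
  have h := hT.consts_subset hc
  simp only [hA, consts_arr, consts, Set.union_subset_iff, Set.singleton_subset_iff] at h
  exact hT.const_of_sort hc ((hT.const_type h.1 .empty hk).arr
    ((hT.const_type h.2.1 .empty hk').arr (hT.const_type h.2.2 .empty hk''))) hΓ hA

theorem app_type (hT : T.IsFragment U.system)
    {e k : USym} (he : e ∈ T.sig.dom) {Γ : Ctx USym} {X : Term USym}
    (hX : T.HasType Γ X (const k)) (hA : declType e = arr (const k) tType := by rfl)
    (hk : declType k = tType := by rfl) :
    T.HasType Γ (app (const e) X) tType :=
  (hT.const_arr_type he hX.wf hA hk).app_arr hX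

theorem const_pi (hT : T.IsFragment U.system)
    {c e k k' k'' : USym} (hc : c ∈ T.sig.dom) {Γ : Ctx USym} (hΓ : T.Wf Γ)
    (hA : declType c =
      Term.pi (const k) (arr (arr (app (const e) (var 0)) (const k')) (const k'')) := by rfl)
    (he : declType e = arr (const k) tType := by rfl) (hk : declType k = tType := by rfl)
    (hk' : declType k' = tType := by rfl) (hk'' : declType k'' = tType := by rfl) :
    T.HasType Γ (const c)
      (Term.pi (const k) (arr (arr (app (const e) (var 0)) (const k')) (const k''))) := by
  have h := hT.consts_subset hc
  simp only [hA, consts_arr, consts, Set.union_subset_iff, Set.singleton_subset_iff] at h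
  have h₁ := hT.const_type h.1 .empty hk
  have h₂ := h₁.weaken_wf
  exact hT.const_of_sort hc (.prod h₁ (((hT.app_type h.2.1.1.1 (.var_zero h₂) he hk).arr
    (hT.const_type h.2.1.2 h₂ hk')).arr (hT.const_type h.2.2 h₂ hk''))) hΓ hA

theorem app_pi (hT : T.IsFragment U.system)
    {c e k k' k'' : USym} (hc : c ∈ T.sig.dom) {Γ : Ctx USym} {X Y : Term USym}
    (hX : T.HasType Γ X (const k)) (hY : T.HasType Γ Y (arr (app (const e) X) (const k')))
    (hA : declType c =
      Term.pi (const k) (arr (arr (app (const e) (var 0)) (const k')) (const k'')) := by rfl)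
    (he : declType e = arr (const k) tType := by rfl) (hk : declType k = tType := by rfl)
    (hk' : declType k' = tType := by rfl) (hk'' : declType k'' = tType := by rfl) :
    T.HasType Γ (bin c X Y) (const k'') :=
  .app (.app (hT.const_pi hc hX.wf hA he hk hk' hk'') hX) hY

end System.IsFragment

end Fragment

end LambdaPi

namespace LambdaPi

open Term

section Fragment

open U

variable {T : System USym}

theorem HasType.mem_dom {C : Type*} {S : Signature C} {R : Set (Rule C)} {Γ : Ctx C} {c : C}
    {D : Term C} (h : HasType S R Γ (const c) D) : c ∈ S.dom :=
  let ⟨A, hA, _⟩ := h.of_const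
  ⟨A, hA⟩

namespace System.IsFragment

/-! ### Building typed terms from the constants of a fragment -/

theorem app_arr (hT : T.IsFragment U.system)
    {c k k' : USym} (hc : c ∈ T.sig.dom) {Γ : Ctx USym} {X : Term USym}
    (hX : T.HasType Γ X (const k)) (hA : declType c = arr (const k) (const k') := by rfl)
    (hk : declType k = tType := by rfl) (hk' : declType k' = tType := by rfl) :
    T.HasType Γ (app (const c) X) (const k') :=
  (hT.const_arr hc hX.wf hA hk hk').app_arr hX

theorem app_arr_arr (hT : T.IsFragment U.system)
    {c k k' k'' : USym} (hc : c ∈ T.sig.dom) {Γ : Ctx USym} {X Y : Term USym}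
    (hX : T.HasType Γ X (const k)) (hY : T.HasType Γ Y (const k'))
    (hA : declType c = arr (const k) (arr (const k') (const k'')) := by rfl)
    (hk : declType k = tType := by rfl) (hk' : declType k' = tType := by rfl)
    (hk'' : declType k'' = tType := by rfl) :
    T.HasType Γ (bin c X Y) (const k'') :=
  ((hT.const_arr_arr hc hX.wf hA hk hk' hk'').app_arr hX).app_arr hY

theorem negneg (hT : T.IsFragment U.system) (hc : .neg ∈ T.sig.dom) {Γ : Ctx USym} {X : Term USym}
    (hX : T.HasType Γ X (const .prop)) : T.HasType Γ (negneg X) (const .prop) :=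
  hT.app_arr hc (hT.app_arr hc hX)

/-- This is the right-hand side shared by the rules for all the dependent arrows, for `∀`, for `π`
and for the two quantifiers over `Set`. -/
theorem pi_app (hT : T.IsFragment U.system)
    {f k : USym} (hf : f ∈ T.sig.dom) {Γ : Ctx USym} {A Y : Term USym}
    (hA : T.HasType Γ A tType) (hY : T.HasType Γ Y (arr A (const k)))
    (he : declType f = arr (const k) tType := by rfl) (hk : declType k = tType := by rfl) :
    T.HasType Γ (Term.pi A (app (const f) (app (rename Nat.succ Y) (var 0)))) tType := by
  have h := hY.weaken hA.weaken_wf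
  rw [rename_arr] at h
  exact .prod hA (hT.app_type hf (h.app_arr (.var_zero hA.weaken_wf)) he hk)

/-- The extension of a context by `x : Set` and `p : El x → Prop`. -/
theorem predicate_ctx (hT : T.IsFragment U.system)
    (hset : .set ∈ T.sig.dom) (hel : .el ∈ T.sig.dom) (hprop : .prop ∈ T.sig.dom)
    {Γ : Ctx USym} (hΓ : T.Wf Γ) :
    T.HasType Γ tSet tType ∧ T.HasType (tSet :: Γ) (arr (el (var 0)) tProp) tType ∧
    T.HasType (arr (el (var 0)) tProp :: tSet :: Γ) (var 1) tSet ∧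
    T.HasType (arr (el (var 0)) tProp :: tSet :: Γ) (var 0) (arr (el (var 1)) tProp) := by
  have h₁ : T.HasType Γ tSet tType := hT.const_type hset hΓ
  have h₂ : T.HasType (tSet :: Γ) (var 0) tSet := .var_zero h₁.weaken_wf
  have h₃ : T.HasType (tSet :: Γ) (arr (el (var 0)) tProp) tType :=
    (hT.app_type hel h₂).arr (hT.const_type hprop h₁.weaken_wf)
  exact ⟨h₁, h₃, h₂.weaken h₃.weaken_wf, .var_zero h₃.weaken_wf⟩

theorem lam_lam_negneg (hT : T.IsFragment U.system)
    {c : USym} (hprop : .prop ∈ T.sig.dom) (hneg : .neg ∈ T.sig.dom)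
    (hc : c ∈ T.sig.dom) {Γ : Ctx USym} (hΓ : T.Wf Γ)
    (hA : declType c = arr tProp (arr tProp tProp) := by rfl) :
    T.HasType Γ (lam tProp (lam tProp (bin c (U.negneg (var 1)) (U.negneg (var 0)))))
      (arr tProp (arr tProp tProp)) := by
  have h₁ : T.HasType Γ tProp tType := hT.const_type hprop hΓ
  have h₂ : T.HasType (tProp :: Γ) tProp tType := hT.const_type hprop h₁.weaken_wf
  have h₃ : T.HasType (tProp :: tProp :: Γ) tProp tType := hT.const_type hprop h₂.weaken_wf
  have hx : T.HasType (tProp :: Γ) (var 0) tProp := .var_zero h₁.weaken_wf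
  exact .abs h₁ (.prod h₂ h₃) (.abs h₂ h₃ (hT.app_arr_arr hc
    (hT.negneg hneg (hx.weaken h₂.weaken_wf)) (hT.negneg hneg (.var_zero h₂.weaken_wf)) hA))

theorem lam_lam_quantifier (hT : T.IsFragment U.system)
    {c : USym} (hset : .set ∈ T.sig.dom) (hel : .el ∈ T.sig.dom)
    (hprop : .prop ∈ T.sig.dom) (hneg : .neg ∈ T.sig.dom) (hc : c ∈ T.sig.dom) {Γ : Ctx USym}
    (hΓ : T.Wf Γ)
    (hA : declType c = Term.pi tSet (arr (arr (el (var 0)) tProp) tProp) := by rfl) :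
    T.HasType Γ (lam tSet (lam (arr (el (var 0)) tProp)
      (bin c (var 1) (lam (el (var 1)) (U.negneg (app (var 1) (var 0)))))))
      (Term.pi tSet (arr (arr (el (var 0)) tProp) tProp)) := by
  obtain ⟨h₁, h₂, hx, hp⟩ := hT.predicate_ctx hset hel hprop hΓ
  have h₃ := hT.const_type hprop h₂.weaken_wf
  have h₄ := hT.app_type hel hx
  have hp' := hp.weaken h₄.weaken_wf
  rw [rename_arr] at hp'
  exact .abs h₁ (.prod h₂ h₃) (.abs h₂ h₃ (hT.app_pi hc hx (.abs h₄
    (hT.const_type hprop h₄.weaken_wf)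
    (hT.negneg hneg (hp'.app_arr (.var_zero h₄.weaken_wf)))) hA))

theorem app_pairDag (hT : T.IsFragment U.system)
    (hc : .pairDag ∈ T.sig.dom) {Γ : Ctx USym} {X P M : Term USym}
    (hX : T.HasType Γ X tSet) (hP : T.HasType Γ P (arr (el X) tProp))
    (hM : T.HasType Γ M (el X)) :
    T.HasType Γ (apps (const .pairDag) [X, P, M]) (el (bin .psub X P)) := by
  have hd := hT.consts_subset hc
  have hA : declType .pairDag = Term.pi tSet (Term.pi (arr (el (var 0)) tProp)
      (arr (el (var 1)) (el (bin .psub (var 1) (var 0))))) := rfl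
  rw [hA] at hd
  simp only [tSet, tProp, el, bin, consts_arr, consts] at hd
  have hel : .el ∈ T.sig.dom := hd (by simp)
  obtain ⟨h₁, h₂, hx, hp⟩ := hT.predicate_ctx (hd (by simp)) hel (hd (by simp))
    (Γ := []) .empty
  have h := hT.const_of_sort hc (.prod h₁ (.prod h₂ ((hT.app_type hel hx).arr
    (hT.app_type hel (hT.app_pi (c := .psub) (k'' := .set) (hd (by simp)) hx hp))))) hX.wf
  have h' := Derivable.app (Derivable.app h hX) hP
  -- Passing under the binder of `p` shifts `X`, and instantiating `p` by `P` undoes the shift.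
  simp only [inst, subst, subst_arr, up, single, bin, subst_single_rename_succ] at h'
  exact HasType.app_arr h' hM

/-! ### Inversion for the constants of U -/

theorem typesConv_arr (hT : T.IsFragment U.system)
    {c : USym} {A B : Term USym} {Γ : Ctx USym} (X : Term USym)
    (hA : declType c = arr A B) : TypesConv T.sig T.rules Γ (app (const c) X) B :=
  TypesConv.app_arr hT.piInjective (hA ▸ hT.typesConv_const c Γ) X

/-- The second component reduces preservation to typing the right-hand side at the declared result
type `B`, whatever the type `D` of the redex. -/
theorem of_app_const (hT : T.IsFragment U.system)
    {c : USym} (k : USym) (B : Term USym) {Γ : Ctx USym} {X D : Term USym}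
    (h : T.HasType Γ (app (const c) X) D) (hA : declType c = arr (const k) B := by rfl)
    (hk : declType k = tType := by rfl) :
    T.HasType Γ X (const k) ∧ ∀ r, T.HasType Γ r B → T.HasType Γ r D := by
  obtain ⟨_, h₀⟩ := h.fun_part
  have hd := hT.consts_subset h₀.mem_dom
  simp only [hA, consts_arr, consts, Set.union_subset_iff, Set.singleton_subset_iff] at hd
  exact ⟨TypesConv.arg hT.piInjective (hA ▸ hT.typesConv_const c Γ) h (hT.const_type hd.1 h.wf hk),
    fun _ => (hT.typesConv_arr X hA).transfer rfl h⟩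

theorem of_app_arr_left (hT : T.IsFragment U.system)
    {c : USym} (k k' : USym) (B : Term USym) {Γ : Ctx USym} {X D : Term USym}
    (h : T.HasType Γ (app (const c) X) D)
    (hA : declType c = arr (arr (const k) (const k')) B := by rfl)
    (hk : declType k = tType := by rfl) (hk' : declType k' = tType := by rfl) :
    T.HasType Γ X (arr (const k) (const k')) := by
  obtain ⟨_, h₀⟩ := h.fun_part
  have hd := hT.consts_subset h₀.mem_dom
  simp only [hA, consts_arr, consts, Set.union_subset_iff, Set.singleton_subset_iff] at hd
  exact TypesConv.arg hT.piInjective (hA ▸ hT.typesConv_const c Γ) h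
    ((hT.const_type hd.1.1 h.wf hk).arr (hT.const_type hd.1.2 h.wf hk'))

theorem of_bin_arr (hT : T.IsFragment U.system)
    {c : USym} (k k' : USym) (B : Term USym) {Γ : Ctx USym} {X Y D : Term USym}
    (h : T.HasType Γ (bin c X Y) D)
    (hA : declType c = arr (const k) (arr (const k') B) := by rfl)
    (hk : declType k = tType := by rfl) (hk' : declType k' = tType := by rfl) :
    T.HasType Γ X (const k) ∧ T.HasType Γ Y (const k') := by
  obtain ⟨_, h₁⟩ := h.fun_part
  obtain ⟨_, h₀⟩ := h₁.fun_part
  have hd := hT.consts_subset h₀.mem_dom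
  simp only [hA, consts_arr, consts, Set.union_subset_iff, Set.singleton_subset_iff] at hd
  exact ⟨(hT.of_app_const k _ h₁ hA hk).1,
    TypesConv.arg hT.piInjective (hT.typesConv_arr X hA) h (hT.const_type hd.2.1 h.wf hk')⟩

theorem of_bin_pi (hT : T.IsFragment U.system)
    {c : USym} (e k k' k'' : USym) {Γ : Ctx USym} {X Y D : Term USym}
    (h : T.HasType Γ (bin c X Y) D)
    (hA : declType c =
      Term.pi (const k) (arr (arr (app (const e) (var 0)) (const k')) (const k'')) := by rfl)
    (he : declType e = arr (const k) tType := by rfl) (hk : declType k = tType := by rfl)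
    (hk' : declType k' = tType := by rfl) :
    T.HasType Γ X (const k) ∧ T.HasType Γ Y (arr (app (const e) X) (const k')) := by
  obtain ⟨_, h₁⟩ := h.fun_part
  obtain ⟨_, h₀⟩ := h₁.fun_part
  have hd := hT.consts_subset h₀.mem_dom
  simp only [hA, consts_arr, consts, Set.union_subset_iff, Set.singleton_subset_iff] at hd
  have hc := hT.typesConv_const c Γ
  rw [hA] at hc
  have hX := TypesConv.arg hT.piInjective hc h₁ (hT.const_type hd.1 h.wf hk)
  exact ⟨hX, TypesConv.arg hT.piInjective (TypesConv.app hT.piInjective hc X) h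
    ((hT.app_type hd.2.1.1.1 hX he hk).arr (hT.const_type hd.2.1.2 h.wf hk'))⟩

/-- The common part of the inversions of `pair`, `pair†` and `fst`. -/
theorem of_bin_predicate (hT : T.IsFragment U.system)
    {c : USym} {B : Term USym} {Γ : Ctx USym} {X P D : Term USym}
    (h : T.HasType Γ (bin c X P) D)
    (hA : declType c = Term.pi tSet (Term.pi (arr (el (var 0)) tProp) B)) :
    T.HasType Γ X tSet ∧ T.HasType Γ P (arr (el X) tProp) ∧ .el ∈ T.sig.dom ∧
    TypesConv T.sig T.rules Γ (bin c X P) (inst P (subst (up (single X)) B)) := by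
  obtain ⟨_, h₁⟩ := h.fun_part
  obtain ⟨_, h₀⟩ := h₁.fun_part
  have hd := hT.consts_subset h₀.mem_dom
  simp only [hA, tSet, tProp, el, consts_arr, consts, Set.union_subset_iff,
    Set.singleton_subset_iff] at hd
  have hc := hT.typesConv_const c Γ
  rw [hA] at hc
  have hX : T.HasType Γ X tSet :=
    TypesConv.arg hT.piInjective hc h₁ (hT.const_type hd.1 h.wf)
  have hc' : TypesConv T.sig T.rules Γ (app (const c) X)
      (Term.pi (arr (el X) tProp) (subst (up (single X)) B)) := TypesConv.app hT.piInjective hc X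
  exact ⟨hX, TypesConv.arg hT.piInjective hc' h
    ((hT.app_type hd.2.1.1.1 hX).arr (hT.const_type hd.2.1.2 h.wf)), hd.2.1.1.1,
    TypesConv.app hT.piInjective hc' P⟩

theorem of_pairDag (hT : T.IsFragment U.system) {Γ : Ctx USym} {X P M D : Term USym}
    (h : T.HasType Γ (apps (const .pairDag) [X, P, M]) D) :
    T.HasType Γ X tSet ∧ T.HasType Γ P (arr (el X) tProp) ∧ T.HasType Γ M (el X) ∧
    Conv T.rules (el (bin .psub X P)) D := by
  obtain ⟨_, h₁⟩ := HasType.fun_part h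
  obtain ⟨hX, hP, hel, hc⟩ := hT.of_bin_predicate
    (B := arr (el (var 1)) (el (bin .psub (var 1) (var 0)))) h₁ rfl
  simp only [inst, el, subst, subst_arr, up, single, bin,
    subst_single_rename_succ] at hc
  exact ⟨hX, hP, TypesConv.arg hT.piInjective hc h (hT.app_type hel hX),
    TypesConv.app_arr hT.piInjective hc M D h⟩

theorem of_fst (hT : T.IsFragment U.system) {Γ : Ctx USym} {X P M D : Term USym}
    (h : T.HasType Γ (apps (const .fst) [X, P, M]) D) :
    T.HasType Γ X tSet ∧ .el ∈ T.sig.dom ∧ T.HasType Γ M (el (bin .psub X P)) ∧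
    ∀ r, T.HasType Γ r (el X) → T.HasType Γ r D := by
  obtain ⟨_, h₁⟩ := HasType.fun_part h
  obtain ⟨_, h₂⟩ := HasType.fun_part h₁
  obtain ⟨_, h₃⟩ := HasType.fun_part h₂
  have hd := hT.consts_subset (HasType.mem_dom h₃)
  have hA : declType .fst = Term.pi tSet (Term.pi (arr (el (var 0)) tProp)
    (arr (el (bin .psub (var 1) (var 0))) (el (var 1)))) := rfl
  obtain ⟨hX, hP, hel, hc⟩ := hT.of_bin_predicate h₁ hA
  rw [hA] at hd
  simp only [tSet, tProp, el, bin, consts_arr, consts] at hd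
  simp only [inst, el, subst, subst_arr, up, single, bin,
    subst_single_rename_succ] at hc
  exact ⟨hX, hel, TypesConv.arg hT.piInjective hc h
    (hT.app_type hel (hT.app_pi (hd (by simp)) hX hP)),
    fun _ => (TypesConv.app_arr hT.piInjective hc M).transfer rfl h⟩

theorem of_pair (hT : T.IsFragment U.system) {Γ : Ctx USym} {X P M H D : Term USym}
    (h : T.HasType Γ (apps (const .pair) [X, P, M, H]) D) :
    T.HasType Γ X tSet ∧ T.HasType Γ P (arr (el X) tProp) ∧ T.HasType Γ M (el X) ∧
    ∀ r, T.HasType Γ r (el (bin .psub X P)) → T.HasType Γ r D := by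
  obtain ⟨_, h₁⟩ := HasType.fun_part h
  obtain ⟨_, h₂⟩ := HasType.fun_part h₁
  obtain ⟨hX, hP, hel, hc⟩ := hT.of_bin_predicate (B := Term.pi (el (var 1))
    (arr (prf (app (var 1) (var 0))) (el (bin .psub (var 2) (var 1))))) h₂ rfl
  simp only [inst, el, prf, subst, subst_arr, up, single, bin, rename, subst_up_rename_succ,
    subst_single_rename_succ] at hc
  have hc' := TypesConv.app hT.piInjective hc M
  simp only [inst, subst, subst_arr, single, subst_single_rename_succ] at hc'
  exact ⟨hX, hP, TypesConv.arg hT.piInjective hc h₁ (hT.app_type hel hX),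
    fun _ => (TypesConv.app_arr hT.piInjective hc' H).transfer rfl h⟩

/-- `El (psub x p)` overlaps with no left-hand side, so all its reducts keep this shape and
confluence compares the arguments. -/
theorem el_psub_inj (hT : T.IsFragment U.system) {X P X' P' : Term USym}
    (h : Conv T.rules (el (bin .psub X P)) (el (bin .psub X' P'))) : Conv T.rules X X' := by
  let sub (X P : Term USym) : ℕ → Term USym
    | 0 => X
    | _ => P
  exact orthogonal_rules.safe_inj (fun _ hρ => hT.rules_subset hρ)
    (p := el (bin .psub (var 0) (var 1))) (θ := sub X P) (σ := sub X' P')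
    (by decide +kernel) (by decide +kernel) (by decide +kernel) h 0 (by decide +kernel)

/-! ### Preservation of typing by each rule -/

theorem preservesTyping (hT : T.IsFragment U.system) {ρ : Rule USym} (hρ : ρ ∈ T.rules) :
    ρ.PreservesTyping T.sig T.rules := by
  intro Γ θ A _ _ _ h
  have hw := h.wf
  have hd : ρ.rhs.consts ⊆ T.sig.dom := (T.rules_mem ρ hρ).2
  have hρ' : ρ ∈ U.rules := hT.rules_subset hρ
  clear hρ
  simp only [U.rules, List.mem_cons, List.not_mem_nil, or_false] at hρ'
  rcases hρ' with rfl | rfl | rfl | rfl | rfl | rfl | rfl | rfl | rfl | rfl | rfl | rfl | rfl |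
    rfl | rfl | rfl | rfl | rfl | rfl | rfl | rfl | rfl | rfl | rfl | rfl | rfl | rfl | rfl |
    rfl | rfl | rfl
  -- Computing the substitution exposes the values of the pattern variables as arguments, in the
  -- form that the inversion lemmas expect.
  all_goals
    simp only [Rule.lhs, apps, List.foldl, tI, tSet, tProp, el, prf, ty, els, U.negneg, bin, subst,
      subst_arr, up, consts, consts_arr] at h hd ⊢
  · exact (hT.of_app_const .set tType h).2 _ (hT.const_type (hd (by simp)) hw)
  · obtain ⟨hG, hr⟩ := hT.of_app_const .prop tType h
    obtain ⟨hX, hY⟩ := hT.of_bin_arr .prop .prop tProp hG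
    exact hr _ ((hT.app_type (hd (by simp)) hX).arr (hT.app_type (hd (by simp)) hY))
  · obtain ⟨hG, hr⟩ := hT.of_app_const .prop tType h
    obtain ⟨hX, hY⟩ := hT.of_bin_pi .el .set .prop .prop hG
    exact hr _ (hT.pi_app (hd (by simp)) (hT.app_type (hd (by simp)) hX) hY)
  · have hP := hT.const_type (c := .prop) (hd (by simp)) hw
    have hz := hT.app_type (e := .prf) (k := .prop) (hd (by simp)) (.var_zero hP.weaken_wf)
    exact (hT.of_app_const .prop tType h).2 _ (.prod hP (hz.arr hz))
  · have hP := hT.const_type (c := .prop) (hd (by simp)) hw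
    have hz := hT.app_type (e := .prf) (k := .prop) (hd (by simp)) (.var_zero hP.weaken_wf)
    exact (hT.of_app_const .prop tType h).2 _ (.prod hP hz)
  · obtain ⟨hG, hr⟩ := hT.of_app_const .prop tType h
    obtain ⟨hX, -⟩ := hT.of_app_const .prop tProp hG
    have hP := hT.const_type (c := .prop) (hd (by simp)) hw
    have hz := hT.app_type (e := .prf) (k := .prop) (hd (by simp)) (.var_zero hP.weaken_wf)
    exact hr _ ((hT.app_type (hd (by simp)) hX).arr (.prod hP hz))
  · obtain ⟨hG, hr⟩ := hT.of_app_const .prop tType h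
    obtain ⟨hX, hY⟩ := hT.of_bin_arr .prop .prop tProp hG
    have hP := hT.const_type (c := .prop) (hd (by simp)) hw
    have hz := hT.app_type (e := .prf) (k := .prop) (hd (by simp)) (.var_zero hP.weaken_wf)
    have hx := hT.app_type (e := .prf) (k := .prop) (hd (by simp)) (hX.weaken hP.weaken_wf)
    have hy := hT.app_type (e := .prf) (k := .prop) (hd (by simp)) (hY.weaken hP.weaken_wf)
    exact hr _ (.prod hP ((hx.arr (hy.arr hz)).arr hz))
  · obtain ⟨hG, hr⟩ := hT.of_app_const .prop tType h
    obtain ⟨hX, hY⟩ := hT.of_bin_arr .prop .prop tProp hG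
    have hP := hT.const_type (c := .prop) (hd (by simp)) hw
    have hz := hT.app_type (e := .prf) (k := .prop) (hd (by simp)) (.var_zero hP.weaken_wf)
    have hx := hT.app_type (e := .prf) (k := .prop) (hd (by simp)) (hX.weaken hP.weaken_wf)
    have hy := hT.app_type (e := .prf) (k := .prop) (hd (by simp)) (hY.weaken hP.weaken_wf)
    exact hr _ (.prod hP ((hx.arr hz).arr ((hy.arr hz).arr hz)))
  · obtain ⟨hG, hr⟩ := hT.of_app_const .prop tType h
    obtain ⟨hX, hY⟩ := hT.of_bin_pi .el .set .prop .prop hG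
    have hP := hT.const_type (c := .prop) (hd (by simp)) hw
    have hprf : .prf ∈ T.sig.dom := hd (by simp)
    have hv : T.HasType (tProp :: Γ) (var 0) tProp := .var_zero hP.weaken_wf
    have hx := hT.app_type (e := .el) (k := .set) (hd (by simp)) (hX.weaken hP.weaken_wf)
    have hy := (hY.weaken hP.weaken_wf).weaken hx.weaken_wf
    rw [rename_arr, rename_arr] at hy
    exact hr _ (.prod hP (HasType.arr (.prod hx ((hT.app_type hprf
      (hy.app_arr (.var_zero hx.weaken_wf))).arr (hT.app_type hprf (hv.weaken hx.weaken_wf))))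
      (hT.app_type hprf hv)))
  · have hP := hT.const_type (c := .prop) (hd (by simp)) hw
    exact (hT.typesConv_const .prfC Γ).transfer rfl h (.abs hP (.sort hP.weaken_wf)
      (hT.app_type (hd (by simp)) (hT.negneg (hd (by simp)) (.var_zero hP.weaken_wf))))
  · exact (hT.typesConv_const .impC Γ).transfer rfl h
      (hT.lam_lam_negneg (hd (by simp)) (hd (by simp)) (hd (by simp)) hw)
  · exact (hT.typesConv_const .andC Γ).transfer rfl h
      (hT.lam_lam_negneg (hd (by simp)) (hd (by simp)) (hd (by simp)) hw)
  · exact (hT.typesConv_const .orC Γ).transfer rfl h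
      (hT.lam_lam_negneg (hd (by simp)) (hd (by simp)) (hd (by simp)) hw)
  · exact (hT.typesConv_const .allC Γ).transfer rfl h (hT.lam_lam_quantifier (hd (by simp))
      (hd (by simp)) (hd (by simp)) (hd (by simp)) (hd (by simp)) hw)
  · exact (hT.typesConv_const .exC Γ).transfer rfl h (hT.lam_lam_quantifier (hd (by simp))
      (hd (by simp)) (hd (by simp)) (hd (by simp)) (hd (by simp)) hw)
  · exact (hT.of_app_const .set tType h).2 _ (hT.const_type (hd (by simp)) hw)
  · obtain ⟨hG, hr⟩ := hT.of_app_const .set tType h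
    obtain ⟨hX, hY⟩ := hT.of_bin_arr .set .set tSet hG
    exact hr _ ((hT.app_type (hd (by simp)) hX).arr (hT.app_type (hd (by simp)) hY))
  · obtain ⟨hG, hr⟩ := hT.of_app_const .set tType h
    obtain ⟨hX, hY⟩ := hT.of_bin_pi .el .set .set .set hG
    exact hr _ (hT.pi_app (hd (by simp)) (hT.app_type (hd (by simp)) hX) hY)
  · obtain ⟨hG, hr⟩ := hT.of_app_const .prop tType h
    obtain ⟨hX, hY⟩ := hT.of_bin_pi .prf .prop .prop .prop hG
    exact hr _ (hT.pi_app (hd (by simp)) (hT.app_type (hd (by simp)) hX) hY)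
  · obtain ⟨hG, hr⟩ := hT.of_app_const .set tType h
    obtain ⟨hX, hY⟩ := hT.of_bin_pi .prf .prop .set .set hG
    exact hr _ (hT.pi_app (hd (by simp)) (hT.app_type (hd (by simp)) hX) hY)
  · obtain ⟨hX, hr⟩ := hT.of_app_const .ind tI h
    exact hr _ hX
  · obtain ⟨hG, hr⟩ := hT.of_app_const .ind tI h
    exact hr _ (hT.of_app_const .ind tI hG).1
  · exact (hT.of_app_const .ind tProp h).2 _ (hT.const_const (hd (by simp)) hw)
  · exact (hT.of_app_const .ind tProp h).2 _ (hT.const_const (hd (by simp)) hw)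
  · obtain ⟨hX, hP, hM, hr⟩ := hT.of_pair h
    exact hr _ (hT.app_pairDag (hd (by simp)) hX hP hM)
  · obtain ⟨hX, hel, hM, hr⟩ := hT.of_fst h
    obtain ⟨-, -, hm, hc⟩ := hT.of_pairDag hM
    -- The component has type `El t'`, from the inversion of `pair†`, and is wanted at type `El t`.
    -- The type of the pair makes `El (psub t' p')` convertible to `El (psub t p)`, hence `t'` to
    -- `t`.
    exact hr _ (.conv hm (hT.app_type hel hX)
      ((hT.el_psub_inj hc).map U.el fun _ _ => Step.appR _))
  · exact (hT.of_app_const .set1 tType h).2 _ (hT.const_type (hd (by simp)) hw)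
  · obtain ⟨hG, hr⟩ := hT.of_app_const .set1 tType h
    obtain ⟨hX, hY⟩ := hT.of_bin_pi .el .set .set1 .set1 hG
    exact hr _ (hT.pi_app (hd (by simp)) (hT.app_type (hd (by simp)) hX) hY)
  · obtain ⟨hG, hr⟩ := hT.of_app_const .scheme tType h
    exact hr _ (hT.app_type (hd (by simp)) (hT.of_app_const .set tScheme hG).1)
  · obtain ⟨hG, hr⟩ := hT.of_app_const .scheme tType h
    exact hr _ (hT.pi_app (hd (by simp)) (hT.const_type (hd (by simp)) hw)
      (hT.of_app_arr_left .set .scheme tScheme hG))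
  · obtain ⟨hG, hr⟩ := hT.of_app_const .prop tType h
    exact hr _ (hT.pi_app (hd (by simp)) (hT.const_type (hd (by simp)) hw)
      (hT.of_app_arr_left .set .prop tProp hG))

theorem isTheory (hT : T.IsFragment U.system) : T.IsTheory where
  confluent := orthogonal_rules.confluentOn T fun _ hρ => hT.rules_subset hρ
  preserves _ hρ := hT.preservesTyping hρ

end System.IsFragment

end Fragment

theorem U.system_isFragment : U.system.IsFragment U.system where
  sig_subset _ h := h
  rules_subset := subset_rfl
  sig_consts _ _ c _ := U.mem_dom c
  rules_closed _ hρ _ := ⟨fun c _ => U.mem_dom c, hρ⟩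

end LambdaPi

/-- Every fragment of the theory U is a theory, and so is U itself. -/
theorem mainTheorem3 :
    (∀ T : LambdaPi.System LambdaPi.USym,
      T.IsFragment LambdaPi.U.system → T.IsTheory) ∧
    LambdaPi.U.system.IsTheory :=
  ⟨fun _ hT => hT.isTheory, LambdaPi.U.system_isFragment.isTheory⟩
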